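/- Let $R$ be an associative unital ring with center $Z(R)$. For $\phi\in\operatorname{Aut}(R)$ and $z\in Z(R)$, let $H(R,\phi,z)$ be the ring generated over $R$ by $x,y$ subject to $$yx=z,\qquad xy=\phi^{-1}(z),\qquad xr=\phi^{-1}(r)x,\qquad yr=\phi(r)y\qquad(r\in R),$$ and let $\mathcal{O}(H(R,\phi,z))$ be the full subcategory of left $H(R,\phi,z)$-modules on which $x$ acts locally nilpotently (every element is annihilated by some power of $x$). For a module $M$ let $M^{z^\infty}$ be the set of elements annihilated by some power of $z$. Let $R_\phi[y]$ denote the twisted polynomial ring with $yr=\phi(r)y$, i.e. the subring of $H(R,\phi,z)$ generated by $R$ and $y$. **Theorem.** Let $b\in Z(R)$ be nilpotent, let $l\ge 1$ be an integer, and let $z\in Z(R)$ and $\phi\in\operatorname{Aut}(R)$ be such that $$\phi^l(z)-z\in bR,\qquad (z,\phi^i(z))=Z(R)\quad\text{for }1\le i\le l-1,$$ where $(z,\phi^i(z))$ is the ideal of $Z(R)$ generated by $z$ and $\phi^i(z)$. Then the functor $$F:\mathcal{O}(H(R,\phi,z))\to\mathcal{O}(H(R,\phi^l,z)),\qquad F(M)=M^{z^\infty},$$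 is an equivalence of categories. Here $F$ sends a homomorphism to its restriction, and $H(R,\phi^l,z)$ acts on $M^{z^\infty}$ as follows: $R$ acts as on $M$, the generator $y$ acts as $y^l$, and the generator $x$ acts as $m\mapsto x^l\,\Phi^{-1}m$, where $\Phi=\phi(z)\phi^2(z)\cdots\phi^{l-1}(z)$, which acts bijectively on $M^{z^\infty}$. Moreover, for every $M\in\mathcal{O}(H(R,\phi,z))$ there is $N\in\mathcal{O}(H(R,\phi^l,z))$ such that $M$, viewed as an $R_\phi[y]$-module, is isomorphic to $R_\phi[y]_{Fr}\otimes_{R_{\phi^l}[y]}N$, where $R_\phi[y]$ is a right $R_{\phi^l}[y]$-module through the $l$-th "Frobenius" homomorphism $Fr:R_{\phi^l}[y]\to R_\phi[y]$, $Fr(y)=y^l$, $Fr(r)=r$ for $r\in R$. -/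

import Mathlib

open CategoryTheory
open scoped TensorProduct

universe u v

noncomputable section

/-! ### Generalized Weyl algebras -/

section GWA

variable {R : Type u} [Ring R]

/-- Generators of a generalized Weyl algebra over `R`: the elements of `R`, and `x`, `y`. -/
inductive GWAGen (R : Type u) : Type u
  | coeff : R → GWAGen R
  | x : GWAGen R
  | y : GWAGen R

/-- The free ring on the elements of `R` and two further letters. -/
abbrev GWAFree (R : Type u) : Type u := FreeAlgebra ℤ (GWAGen R)

/-- The letter attached to an element of `R`. -/
def GWAFree.c (r : R) : GWAFree R := FreeAlgebra.ι ℤ (GWAGen.coeff r)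

/-- The letter `x`. -/
def GWAFree.x (R : Type u) : GWAFree R := FreeAlgebra.ι ℤ GWAGen.x

/-- The letter `y`. -/
def GWAFree.y (R : Type u) : GWAFree R := FreeAlgebra.ι ℤ GWAGen.y

/-- The relations of `H(R, φ, z)`: the first three say that `R` maps to the quotient by a ring
homomorphism, the others are `yx = z`, `xy = φ⁻¹(z)`, `xr = φ⁻¹(r)x` and `yr = φ(r)y`. -/
inductive GWARel (φ : RingAut R) (z : R) : GWAFree R → GWAFree R → Prop
  | one : GWARel φ z (GWAFree.c 1) 1
  | add (r s : R) : GWARel φ z (GWAFree.c (r + s)) (GWAFree.c r + GWAFree.c s)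
  | mul (r s : R) : GWARel φ z (GWAFree.c (r * s)) (GWAFree.c r * GWAFree.c s)
  | yx : GWARel φ z (GWAFree.y R * GWAFree.x R) (GWAFree.c z)
  | xy : GWARel φ z (GWAFree.x R * GWAFree.y R) (GWAFree.c (φ⁻¹ z))
  | xr (r : R) : GWARel φ z (GWAFree.x R * GWAFree.c r) (GWAFree.c (φ⁻¹ r) * GWAFree.x R)
  | yr (r : R) : GWARel φ z (GWAFree.y R * GWAFree.c r) (GWAFree.c (φ r) * GWAFree.y R)

/-- The generalized Weyl algebra `H(R, φ, z)`: the ring generated over `R` by `x` and `y` subject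
to `yx = z`, `xy = φ⁻¹(z)`, `xr = φ⁻¹(r)x`, `yr = φ(r)y`. -/
def GWA (φ : RingAut R) (z : R) : Type u := RingQuot (GWARel φ z)

instance (φ : RingAut R) (z : R) : Ring (GWA φ z) := inferInstanceAs (Ring (RingQuot _))

namespace GWA

variable (φ : RingAut R) (z : R)

/-- The quotient map from the free ring. -/
def mk : GWAFree R →+* GWA φ z := RingQuot.mkRingHom (GWARel φ z)

/-- The structure map `R → H(R, φ, z)`. -/
def C : R →+* GWA φ z where
  toFun r := mk φ z (GWAFree.c r)
  map_one' := (RingQuot.mkRingHom_rel GWARel.one).trans (map_one _)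
  map_mul' r s := (RingQuot.mkRingHom_rel (GWARel.mul r s)).trans (map_mul _ _ _)
  map_add' r s := (RingQuot.mkRingHom_rel (GWARel.add r s)).trans (map_add _ _ _)
  map_zero' := by
    have h : mk φ z (GWAFree.c (0 + 0)) = _ :=
      (RingQuot.mkRingHom_rel (GWARel.add (φ := φ) (z := z) 0 0)).trans (map_add _ _ _)
    rw [add_zero] at h
    exact left_eq_add.mp h

/-- The generator `x` of `H(R, φ, z)`. -/
def x : GWA φ z := mk φ z (GWAFree.x R)

/-- The generator `y` of `H(R, φ, z)`. -/
def y : GWA φ z := mk φ z (GWAFree.y R)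

theorem y_mul_x : y φ z * x φ z = C φ z z :=
  (map_mul _ _ _).symm.trans (RingQuot.mkRingHom_rel GWARel.yx)

theorem x_mul_y : x φ z * y φ z = C φ z (φ⁻¹ z) :=
  (map_mul _ _ _).symm.trans (RingQuot.mkRingHom_rel GWARel.xy)

theorem x_mul_C (r : R) : x φ z * C φ z r = C φ z (φ⁻¹ r) * x φ z :=
  (map_mul _ _ _).symm.trans ((RingQuot.mkRingHom_rel (GWARel.xr r)).trans (map_mul _ _ _))

theorem y_mul_C (r : R) : y φ z * C φ z r = C φ z (φ r) * y φ z :=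
  (map_mul _ _ _).symm.trans ((RingQuot.mkRingHom_rel (GWARel.yr r)).trans (map_mul _ _ _))

theorem x_pow_mul_C (n : ℕ) (r : R) :
    x φ z ^ n * C φ z r = C φ z ((φ ^ n)⁻¹ r) * x φ z ^ n := by
  induction n generalizing r with
  | zero => simp
  | succ n ih =>
    rw [pow_succ, mul_assoc, x_mul_C, ← mul_assoc, ih, mul_assoc, pow_succ' φ, mul_inv_rev]
    rfl

theorem y_pow_mul_C (n : ℕ) (r : R) :
    y φ z ^ n * C φ z r = C φ z ((φ ^ n) r) * y φ z ^ n := by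
  induction n generalizing r with
  | zero => simp
  | succ n ih =>
    rw [pow_succ, mul_assoc, y_mul_C, ← mul_assoc, ih, mul_assoc, pow_succ φ]
    rfl

variable {φ z}

theorem induction {P : GWA φ z → Prop} (hC : ∀ r, P (C φ z r)) (hx : P (x φ z)) (hy : P (y φ z))
    (hadd : ∀ a b, P a → P b → P (a + b)) (hmul : ∀ a b, P a → P b → P (a * b))
    (a : GWA φ z) : P a := by
  obtain ⟨a, rfl⟩ := RingQuot.mkRingHom_surjective (GWARel φ z) a
  change P (mk φ z a)
  induction a using FreeAlgebra.induction with
  | grade0 n =>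
    have := hC (n : R)
    rwa [map_intCast, ← map_intCast (mk φ z)] at this
  | grade1 g =>
    cases g with
    | coeff r => exact hC r
    | x => exact hx
    | y => exact hy
  | mul a b ha hb => rw [map_mul]; exact hmul _ _ ha hb
  | add a b ha hb => rw [map_add]; exact hadd _ _ ha hb

/-- The images of the generators under the map of `GWA.lift`. -/
def liftGen {A : Type*} (f : R → A) (X Y : A) : GWAGen R → A
  | .coeff r => f r
  | .x => X
  | .y => Y

/-- The universal property of `H(R, φ, z)`. -/
def lift {A : Type*} [Ring A] (f : R →+* A) (X Y : A) (hyx : Y * X = f z)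
    (hxy : X * Y = f (φ⁻¹ z)) (hx : ∀ r, X * f r = f (φ⁻¹ r) * X)
    (hy : ∀ r, Y * f r = f (φ r) * Y) : GWA φ z →+* A :=
  RingQuot.lift ⟨(FreeAlgebra.lift ℤ (liftGen f X Y) : GWAFree R →+* A), by
    intro a b h
    cases h <;> simp [GWAFree.c, GWAFree.x, GWAFree.y, liftGen, *]⟩

section lift

variable {A : Type*} [Ring A] (f : R →+* A) (X Y : A) (hyx : Y * X = f z)
    (hxy : X * Y = f (φ⁻¹ z)) (hx : ∀ r, X * f r = f (φ⁻¹ r) * X)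
    (hy : ∀ r, Y * f r = f (φ r) * Y)

@[simp] theorem lift_C (r : R) : lift f X Y hyx hxy hx hy (C φ z r) = f r :=
  (RingQuot.lift_mkRingHom_apply _ _ _).trans (by simp [GWAFree.c, liftGen])

@[simp] theorem lift_x : lift f X Y hyx hxy hx hy (x φ z) = X :=
  (RingQuot.lift_mkRingHom_apply _ _ _).trans (by simp [GWAFree.x, liftGen])

@[simp] theorem lift_y : lift f X Y hyx hxy hx hy (y φ z) = Y :=
  (RingQuot.lift_mkRingHom_apply _ _ _).trans (by simp [GWAFree.y, liftGen])

end lift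

end GWA

/-! ### Category `𝒪` -/

/-- The left `H(R, φ, z)`-modules on which `x` acts locally nilpotently. -/
def isLocallyXNilpotent (φ : RingAut R) (z : R) : ObjectProperty (ModuleCat.{v} (GWA φ z)) :=
  fun M => ∀ m : M, ∃ n : ℕ, GWA.x φ z ^ n • m = 0

/-- The category `𝒪(H(R, φ, z))`, a full subcategory of the category of left modules. -/
abbrev CategoryO (φ : RingAut R) (z : R) := (isLocallyXNilpotent.{u, v} φ z).FullSubcategory

/-! ### Twisted polynomials, and extension of scalars over noncommutative rings -/

/-- A copy of `R` on which the monoid `ℕ` acts through the powers of `φ`. -/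
def Twist (_φ : RingAut R) : Type u := R

instance (φ : RingAut R) : Ring (Twist φ) := inferInstanceAs (Ring R)

instance (φ : RingAut R) : MulSemiringAction (Multiplicative ℕ) (Twist φ) where
  smul n r := (φ ^ n.toAdd) (r : R)
  one_smul _ := rfl
  mul_smul m n r := congrArg (fun ψ : RingAut R => ψ r) (pow_add φ m.toAdd n.toAdd)
  smul_zero n := map_zero (φ ^ n.toAdd)
  smul_add n := map_add (φ ^ n.toAdd)
  smul_one n := map_one (φ ^ n.toAdd)
  smul_mul n := map_mul (φ ^ n.toAdd)

/-- The twisted polynomial ring `R[y]`, with elements `∑ rᵢ yⁱ` and multiplication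
`y r = φ(r) y`. -/
abbrev TwistedPoly (φ : RingAut R) : Type u := SkewPolynomial (Twist φ)

namespace TwistedPoly

/-- The inclusion `R → R[y]`. -/
def C (φ : RingAut R) : R →+* TwistedPoly φ := SkewPolynomial.CRingHom (R := Twist φ)

/-- The variable `y` of `R[y]`. -/
def y (φ : RingAut R) : TwistedPoly φ := SkewPolynomial.X

theorem pow_mul_comm {φ : RingAut R} {A : Type*} [Ring A] (f : R →+* A) (Y : A)
    (hY : ∀ r, Y * f r = f (φ r) * Y) (k : ℕ) (r : R) :
    f ((φ ^ k) r) * Y ^ k = Y ^ k * f r := by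
  induction k generalizing r with
  | zero => simp
  | succ k ih =>
    rw [pow_succ Y, mul_assoc (Y ^ k), hY, ← mul_assoc (Y ^ k), ← ih, mul_assoc, pow_succ φ]
    rfl

/-- The ring homomorphism out of `R[y]` given by its restriction to `R` and the image of `y`. -/
def lift {φ : RingAut R} {A : Type*} [Ring A] (f : R →+* A) (Y : A)
    (hY : ∀ r, Y * f r = f (φ r) * Y) : TwistedPoly φ →+* A :=
  SkewMonoidAlgebra.liftNCRingHom (k := Twist φ) (show Twist φ →+* A from f) (powersHom A Y)
    fun {r n} => pow_mul_comm f Y hY n.toAdd r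

section lift

variable {φ : RingAut R} {A : Type*} [Ring A] (f : R →+* A) (Y : A)
    (hY : ∀ r, Y * f r = f (φ r) * Y)

@[simp] theorem lift_C (r : R) : lift f Y hY (C φ r) = f r :=
  (SkewMonoidAlgebra.liftNC_single _ _ _ _).trans
    ((congrArg (f r * ·) (map_one (powersHom A Y))).trans (mul_one _))

@[simp] theorem lift_y : lift f Y hY (y φ) = Y :=
  (SkewMonoidAlgebra.liftNC_single _ _ _ _).trans
    ((congrArg₂ (· * ·) (map_one f) (pow_one Y)).trans (one_mul _))

end lift

theorem y_mul_C (φ : RingAut R) (r : R) : y φ * C φ r = C φ (φ r) * y φ := by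
  refine (SkewMonoidAlgebra.single_mul_single (k := Twist φ)).trans
    (Eq.trans ?_ (SkewMonoidAlgebra.single_mul_single (k := Twist φ)).symm)
  exact congrArg₂ SkewMonoidAlgebra.single ((mul_one _).trans (one_mul _).symm)
    ((one_mul (φ r)).trans (mul_one (φ r)).symm)

theorem y_pow_mul_C (φ : RingAut R) (n : ℕ) (r : R) :
    y φ ^ n * C φ r = C φ ((φ ^ n) r) * y φ ^ n := by
  induction n generalizing r with
  | zero => simp
  | succ n ih =>
    rw [pow_succ, mul_assoc, y_mul_C, ← mul_assoc, ih, mul_assoc, pow_succ φ]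
    rfl

/-- The map `R[y] → H(R, φ, z)` identifying the twisted polynomial ring with the subring of
`H(R, φ, z)` generated by `R` and `y`. -/
def toGWA (φ : RingAut R) (z : R) : TwistedPoly φ →+* GWA φ z :=
  lift (GWA.C φ z) (GWA.y φ z) (GWA.y_mul_C φ z)

/-- The `l`-th Frobenius `Fr`, the identity on `R` and `y ↦ y ^ l`; its source is the ring `R[y]`
twisted by `φ ^ l`. -/
def frobenius (φ : RingAut R) (l : ℕ) : TwistedPoly (φ ^ l) →+* TwistedPoly φ :=
  lift (C φ) (y φ ^ l) (y_pow_mul_C φ l)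

end TwistedPoly

end GWA

/-- For a ring homomorphism `f : A → B` of not necessarily commutative rings and a left `A`-module
`N`, the left `B`-module `B ⊗_A N`, where `B` is a right `A`-module through `f`: the quotient of
`B ⊗_ℤ N` by the relations `b f(a) ⊗ n = b ⊗ a n`. -/
abbrev ExtendScalars {A B : Type*} [Ring A] [Ring B] (f : A →+* B) (N : Type*) [AddCommGroup N]
    [Module A N] :=
  (B ⊗[ℤ] N) ⧸ Submodule.span B
    {t : B ⊗[ℤ] N | ∃ (b : B) (a : A) (n : N), t = (b * f a) ⊗ₜ[ℤ] n - b ⊗ₜ[ℤ] (a • n)}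

/-! ### The functor `M ↦ M^{z^∞}` -/

section Torsion

variable {R : Type u} [Ring R] (φ : RingAut R) (z : Subring.center R) (l : ℕ)

/-- `M^{z^∞}`: the elements of the `H(R, φ, z)`-module `M` annihilated by some power of `z`. -/
def zTorsion (M : Type v) [AddCommGroup M] [Module (GWA φ (z : R)) M] : AddSubgroup M where
  carrier := {m | ∃ n : ℕ, GWA.C φ (z : R) (z : R) ^ n • m = 0}
  zero_mem' := ⟨0, smul_zero _⟩
  add_mem' := by
    rintro a b ⟨n, hn⟩ ⟨k, hk⟩
    refine ⟨n + k, ?_⟩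
    rw [smul_add, pow_add, mul_smul _ _ b, hk, smul_zero, add_zero, ← pow_add, add_comm, pow_add,
      mul_smul, hn, smul_zero]
  neg_mem' := by
    rintro a ⟨n, hn⟩
    exact ⟨n, by rw [smul_neg, hn, neg_zero]⟩

/-- The central element `φ(z) φ²(z) ⋯ φ^{l-1}(z)`. -/
def rescaling : Subring.center R := ∏ i ∈ Finset.Ico 1 l, Subring.centerCongr (φ ^ i) z

namespace zTorsion

section algebra

variable {φ z l}

theorem y_pow_mul_x_pow (n : ℕ) : GWA.y φ (z : R) ^ n * GWA.x φ (z : R) ^ n =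
    GWA.C φ (z : R) (∏ i ∈ Finset.range n, Subring.centerCongr (φ ^ i) z : Subring.center R) := by
  induction n with
  | zero => simp
  | succ n ih =>
    rw [pow_succ, pow_succ', mul_assoc, ← mul_assoc (GWA.y φ (z : R)), GWA.y_mul_x, ← mul_assoc,
      GWA.y_pow_mul_C, mul_assoc, ih, ← map_mul, Finset.prod_range_succ, mul_comm]
    rfl

theorem x_pow_mul_y_pow (n : ℕ) : GWA.x φ (z : R) ^ n * GWA.y φ (z : R) ^ n =
    GWA.C φ (z : R) ((φ ^ n)⁻¹
      (∏ i ∈ Finset.range n, Subring.centerCongr (φ ^ i) z : Subring.center R)) := by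
  have key : ∀ n, GWA.x φ (z : R) ^ n * GWA.y φ (z : R) ^ n = GWA.C φ (z : R)
      (∏ i ∈ Finset.range n, Subring.centerCongr ((φ ^ (i + 1))⁻¹) z : Subring.center R) := by
    intro n
    induction n with
    | zero => simp
    | succ n ih =>
      rw [pow_succ, pow_succ' (GWA.y φ (z : R)), mul_assoc, ← mul_assoc (GWA.x φ (z : R)),
        GWA.x_mul_y, ← mul_assoc, GWA.x_pow_mul_C, mul_assoc, ih, ← map_mul,
        Finset.prod_range_succ, mul_comm, pow_succ' φ n, mul_inv_rev]
      rfl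
  rw [key]
  congr 1
  rw [← Finset.prod_range_reflect]
  have h : ((φ ^ n)⁻¹ (∏ i ∈ Finset.range n, Subring.centerCongr (φ ^ i) z : Subring.center R) : R)
    = ((Subring.centerCongr ((φ ^ n)⁻¹) (∏ i ∈ Finset.range n, Subring.centerCongr (φ ^ i) z) :
      Subring.center R) : R) := rfl
  rw [h, map_prod]
  congr 1
  refine Finset.prod_congr rfl fun i hi => ?_
  have hi := Finset.mem_range.mp hi
  apply Subtype.ext
  change (φ ^ (n - 1 - i + 1))⁻¹ (z : R) = ((φ ^ n)⁻¹ * φ ^ i) (z : R)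
  congr 1
  rw [eq_inv_mul_iff_mul_eq, ← div_eq_mul_inv, div_eq_iff_eq_mul, ← pow_add]
  congr 1
  omega

theorem prod_range_eq (hl : 1 ≤ l) :
    ∏ i ∈ Finset.range l, Subring.centerCongr (φ ^ i) z = z * rescaling φ z l := by
  rw [Finset.range_eq_Ico, Finset.prod_eq_prod_Ico_succ_bot hl, rescaling]
  rfl

theorem isCoprime_rescaling
    (hcop : ∀ i, 1 ≤ i → i ≤ l - 1 → Ideal.span {z, Subring.centerCongr (φ ^ i) z} = ⊤) :
    IsCoprime z (rescaling φ z l) := by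
  refine IsCoprime.prod_right fun i hi => ?_
  rw [Finset.mem_Ico] at hi
  have h := hcop i hi.1 (by omega)
  rw [Ideal.eq_top_iff_one, Ideal.mem_span_pair] at h
  exact h

theorem isNilpotent_inv (h : IsNilpotent (Subring.centerCongr (φ ^ l) z - z)) :
    IsNilpotent (Subring.centerCongr ((φ ^ l)⁻¹) z - z) := by
  have h1 := (h.map (Subring.centerCongr ((φ ^ l)⁻¹))).neg
  rw [map_sub, neg_sub] at h1
  have e : Subring.centerCongr ((φ ^ l)⁻¹) (Subring.centerCongr (φ ^ l) z) = z := by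
    apply Subtype.ext
    change ((φ ^ l)⁻¹ * φ ^ l) (z : R) = z
    rw [inv_mul_cancel, RingAut.one_apply]
  rwa [e] at h1

end algebra

variable {φ z l}
variable {M : Type v} [AddCommGroup M] [Module (GWA φ (z : R)) M]

theorem exists_pow_smul {w w' : Subring.center R} (h : IsNilpotent (w' - w)) {m : M}
    (hm : ∃ n : ℕ, GWA.C φ (z : R) (w : R) ^ n • m = 0) :
    ∃ n : ℕ, GWA.C φ (z : R) (w' : R) ^ n • m = 0 := by
  obtain ⟨t, ht⟩ := h
  obtain ⟨n, hn⟩ := hm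
  refine ⟨n + t - 1, ?_⟩
  have h1 : (w + (w' - w)) ^ (n + t - 1) ∈ Ideal.span {w ^ n} :=
    Ideal.add_pow_add_pred_mem_of_pow_mem _ (Ideal.mem_span_singleton_self _)
      (by rw [ht]; exact zero_mem _)
  obtain ⟨a, ha⟩ := Ideal.mem_span_singleton'.mp h1
  rw [add_sub_cancel] at ha
  rw [← map_pow, ← SubmonoidClass.coe_pow, ← ha, Subring.coe_mul, map_mul, mul_smul,
    SubmonoidClass.coe_pow, map_pow, hn, smul_zero]

theorem pow_smul_of_le {a : GWA φ (z : R)} {m : M} {n k : ℕ} (h : a ^ n • m = 0) (hk : n ≤ k) :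
    a ^ k • m = 0 := by
  rw [← Nat.sub_add_cancel hk, pow_add, mul_smul, h, smul_zero]

theorem C_smul_mem (r : R) {m : M} (hm : m ∈ zTorsion φ z M) :
    GWA.C φ (z : R) r • m ∈ zTorsion φ z M := by
  obtain ⟨n, hn⟩ := hm
  refine ⟨n, ?_⟩
  have h : (z : R) ^ n * r = r * (z : R) ^ n :=
    Commute.pow_left (Subring.mem_center_iff.mp z.2 r).symm n
  rw [← mul_smul, ← map_pow, ← map_mul, h, map_mul, mul_smul, map_pow, hn, smul_zero]

theorem y_pow_smul_mem (h : IsNilpotent (Subring.centerCongr (φ ^ l) z - z)) {m : M}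
    (hm : m ∈ zTorsion φ z M) : GWA.y φ (z : R) ^ l • m ∈ zTorsion φ z M := by
  obtain ⟨n, hn⟩ := exists_pow_smul (isNilpotent_inv h) hm
  refine ⟨n, ?_⟩
  have h1 := GWA.y_pow_mul_C φ (z : R) l (((φ ^ l)⁻¹ (z : R)) ^ n)
  rw [map_pow (φ ^ l), ← RingAut.mul_apply, mul_inv_cancel, RingAut.one_apply] at h1
  rw [← mul_smul, ← map_pow, ← h1, mul_smul, map_pow]
  exact (congrArg _ hn).trans (smul_zero _)

theorem x_pow_smul_mem (h : IsNilpotent (Subring.centerCongr (φ ^ l) z - z)) {m : M}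
    (hm : m ∈ zTorsion φ z M) : GWA.x φ (z : R) ^ l • m ∈ zTorsion φ z M := by
  obtain ⟨n, hn⟩ := exists_pow_smul h hm
  refine ⟨n, ?_⟩
  have h1 := GWA.x_pow_mul_C φ (z : R) l (((φ ^ l) (z : R)) ^ n)
  rw [map_pow ((φ ^ l)⁻¹), ← RingAut.mul_apply, inv_mul_cancel, RingAut.one_apply] at h1
  rw [← mul_smul, ← map_pow, ← h1, mul_smul, map_pow]
  exact (congrArg _ hn).trans (smul_zero _)

/-- `R` acts on `M^{z^∞}`. -/
def actC (φ : RingAut R) (z : Subring.center R) (M : Type v) [AddCommGroup M]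
    [Module (GWA φ (z : R)) M] : R →+* AddMonoid.End (zTorsion φ z M) where
  toFun r :=
    { toFun := fun m => ⟨GWA.C φ (z : R) r • (m : M), C_smul_mem r m.2⟩
      map_zero' := Subtype.ext (smul_zero _)
      map_add' := fun _ _ => Subtype.ext (smul_add _ _ _) }
  map_one' := AddMonoidHom.ext fun m => Subtype.ext (by
    change GWA.C φ (z : R) 1 • (m : M) = m
    rw [map_one, one_smul])
  map_zero' := AddMonoidHom.ext fun m => Subtype.ext (by
    change GWA.C φ (z : R) 0 • (m : M) = 0
    rw [map_zero, zero_smul])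
  map_mul' r s := AddMonoidHom.ext fun m => Subtype.ext (by
    change GWA.C φ (z : R) (r * s) • (m : M) = GWA.C φ (z : R) r • GWA.C φ (z : R) s • (m : M)
    rw [map_mul, mul_smul])
  map_add' r s := AddMonoidHom.ext fun m => Subtype.ext (by
    change GWA.C φ (z : R) (r + s) • (m : M) =
      GWA.C φ (z : R) r • (m : M) + GWA.C φ (z : R) s • (m : M)
    rw [map_add, add_smul])

@[simp] theorem coe_actC (r : R) (m : zTorsion φ z M) :
    (actC φ z M r m : M) = GWA.C φ (z : R) r • (m : M) := rfl

/-- The operator `y ^ l` on `M^{z^∞}`. -/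
def actY (M : Type v) [AddCommGroup M] [Module (GWA φ (z : R)) M]
    (h : IsNilpotent (Subring.centerCongr (φ ^ l) z - z)) : AddMonoid.End (zTorsion φ z M) where
  toFun m := ⟨GWA.y φ (z : R) ^ l • (m : M), y_pow_smul_mem h m.2⟩
  map_zero' := Subtype.ext (smul_zero _)
  map_add' _ _ := Subtype.ext (smul_add _ _ _)

@[simp] theorem coe_actY (h : IsNilpotent (Subring.centerCongr (φ ^ l) z - z))
    (m : zTorsion φ z M) : (actY M h m : M) = GWA.y φ (z : R) ^ l • (m : M) := rfl

/-- The operator `x ^ l` on `M^{z^∞}`. -/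
def xPow (M : Type v) [AddCommGroup M] [Module (GWA φ (z : R)) M]
    (h : IsNilpotent (Subring.centerCongr (φ ^ l) z - z)) : AddMonoid.End (zTorsion φ z M) where
  toFun m := ⟨GWA.x φ (z : R) ^ l • (m : M), x_pow_smul_mem h m.2⟩
  map_zero' := Subtype.ext (smul_zero _)
  map_add' _ _ := Subtype.ext (smul_add _ _ _)

@[simp] theorem coe_xPow (h : IsNilpotent (Subring.centerCongr (φ ^ l) z - z))
    (m : zTorsion φ z M) : (xPow M h m : M) = GWA.x φ (z : R) ^ l • (m : M) := rfl

theorem exists_inverse (hc : IsCoprime z (rescaling φ z l)) (n : ℕ) :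
    ∃ c a : Subring.center R, a * z ^ n + c * rescaling φ z l = 1 := by
  obtain ⟨a, c, h⟩ := hc.pow_left (m := n)
  exact ⟨c, a, h⟩

theorem smul_inverse {n : ℕ} {c a : Subring.center R}
    (h : a * z ^ n + c * rescaling φ z l = 1) {m : M} (hm : GWA.C φ (z : R) (z : R) ^ n • m = 0) :
    GWA.C φ (z : R) (c : R) • GWA.C φ (z : R) (rescaling φ z l : R) • m = m := by
  have h1 := congrArg (fun t : Subring.center R => GWA.C φ (z : R) (t : R) • m) h
  simp only [Subring.coe_add, Subring.coe_mul, SubmonoidClass.coe_pow, map_add, map_mul, map_pow,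
    add_smul, mul_smul, hm, smul_zero, zero_add, Subring.coe_one, map_one, one_smul] at h1
  exact h1

theorem bijective_rescaling (hc : IsCoprime z (rescaling φ z l)) :
    Function.Bijective (actC φ z M (rescaling φ z l : R)) := by
  constructor
  · rw [injective_iff_map_eq_zero]
    rintro ⟨m, n, hm⟩ h0
    obtain ⟨c, a, h⟩ := exists_inverse hc n
    apply Subtype.ext
    have h1 := congrArg Subtype.val h0
    exact (smul_inverse h hm).symm.trans ((congrArg _ h1).trans (smul_zero _))
  · rintro ⟨m, n, hm⟩
    obtain ⟨c, a, h⟩ := exists_inverse hc n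
    refine ⟨⟨GWA.C φ (z : R) (c : R) • m, C_smul_mem _ ⟨n, hm⟩⟩, Subtype.ext ?_⟩
    refine Eq.trans ?_ (smul_inverse h hm)
    change GWA.C φ (z : R) _ • GWA.C φ (z : R) _ • m = _
    rw [← mul_smul, ← mul_smul, ← map_mul, ← map_mul, ← Subring.coe_mul, ← Subring.coe_mul,
      mul_comm]

/-- The inverse of the bijective action of `φ(z) φ²(z) ⋯ φ^{l-1}(z)` on `M^{z^∞}`. -/
def rescale (M : Type v) [AddCommGroup M] [Module (GWA φ (z : R)) M]
    (hc : IsCoprime z (rescaling φ z l)) : AddMonoid.End (zTorsion φ z M) :=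
  ((AddEquiv.ofBijective (actC φ z M (rescaling φ z l : R)) (bijective_rescaling hc)).symm :
    zTorsion φ z M →+ zTorsion φ z M)

theorem actC_rescale (hc : IsCoprime z (rescaling φ z l)) (m : zTorsion φ z M) :
    actC φ z M (rescaling φ z l : R) (rescale M hc m) = m :=
  (AddEquiv.ofBijective (actC φ z M (rescaling φ z l : R))
    (bijective_rescaling hc)).apply_symm_apply m

theorem rescale_eq (hc : IsCoprime z (rescaling φ z l)) {n : ℕ} {c a : Subring.center R}
    (h : a * z ^ n + c * rescaling φ z l = 1) (m : zTorsion φ z M)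
    (hm : GWA.C φ (z : R) (z : R) ^ n • (m : M) = 0) :
    (rescale M hc m : M) = GWA.C φ (z : R) (c : R) • (m : M) := by
  have h1 : rescale M hc m = actC φ z M (c : R) m := by
    apply (bijective_rescaling (M := M) hc).1
    rw [actC_rescale]
    apply Subtype.ext
    refine (smul_inverse h hm).symm.trans ?_
    change GWA.C φ (z : R) _ • GWA.C φ (z : R) _ • (m : M) =
      GWA.C φ (z : R) _ • GWA.C φ (z : R) _ • (m : M)
    rw [← mul_smul, ← mul_smul, ← map_mul, ← map_mul, ← Subring.coe_mul, ← Subring.coe_mul,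
      mul_comm]
  rw [h1]
  rfl

theorem rescale_actC (hc : IsCoprime z (rescaling φ z l)) (r : R) (m : zTorsion φ z M) :
    rescale M hc (actC φ z M r m) = actC φ z M r (rescale M hc m) := by
  apply (bijective_rescaling (M := M) hc).1
  rw [actC_rescale]
  conv_lhs => rw [← actC_rescale hc m]
  change (actC φ z M r * actC φ z M _) _ = (actC φ z M _ * actC φ z M r) _
  rw [← map_mul, ← map_mul, Subring.mem_center_iff.mp (rescaling φ z l).2 r]

/-- The action of `H(R, φ ^ l, z)` on `M^{z^∞}`: `R` acts as it does on `M`, the generator `y` acts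
as `y ^ l`, and `x` acts as `x ^ l` composed with the inverse of `φ(z) φ²(z) ⋯ φ^{l-1}(z)`, so that
`yx` acts as `z`. -/
def action (M : Type v) [AddCommGroup M] [Module (GWA φ (z : R)) M] (hl : 1 ≤ l)
    (h : IsNilpotent (Subring.centerCongr (φ ^ l) z - z))
    (hc : IsCoprime z (rescaling φ z l)) :
    GWA (φ ^ l) (z : R) →+* AddMonoid.End (zTorsion φ z M) :=
  GWA.lift (actC φ z M) (xPow M h * rescale M hc) (actY M h)
    (by
      ext m
      change GWA.y φ (z : R) ^ l • GWA.x φ (z : R) ^ l • (rescale M hc m : M) = _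
      rw [← mul_smul, y_pow_mul_x_pow, prod_range_eq hl, Subring.coe_mul, map_mul, mul_smul]
      exact congrArg _ (congrArg Subtype.val (actC_rescale hc m)))
    (by
      ext m
      change GWA.x φ (z : R) ^ l • (rescale M hc (actY M h m) : M) =
        GWA.C φ (z : R) ((φ ^ l)⁻¹ (z : R)) • (m : M)
      obtain ⟨n, hn⟩ := (actY M h m).2
      obtain ⟨k, hk⟩ := exists_pow_smul (isNilpotent_inv h) m.2
      obtain ⟨c, a, hca⟩ := exists_inverse hc (n + k)
      rw [rescale_eq hc hca _ (pow_smul_of_le hn (by omega)), coe_actY, ← mul_smul, ← mul_smul,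
        GWA.x_pow_mul_C, mul_assoc, x_pow_mul_y_pow, prod_range_eq hl, ← map_mul, ← map_mul,
        ← Subring.coe_mul, mul_left_comm, Subring.coe_mul, map_mul, map_mul, mul_smul]
      congr 1
      have h1 := congrArg (fun t : Subring.center R =>
        GWA.C φ (z : R) ((φ ^ l)⁻¹ (t : R)) • (m : M)) hca
      have h2 : GWA.C φ (z : R) ((φ ^ l)⁻¹ (z : R)) ^ (n + k) • (m : M) = 0 :=
        pow_smul_of_le hk (by omega)
      simp only [Subring.coe_add, Subring.coe_one, map_add, map_one, one_smul, add_smul] at h1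
      rw [Subring.coe_mul, map_mul, map_mul, mul_smul, SubmonoidClass.coe_pow, map_pow, map_pow, h2,
        smul_zero, zero_add] at h1
      exact h1)
    (by
      intro r
      ext m
      change GWA.x φ (z : R) ^ l • (rescale M hc (actC φ z M r m) : M) =
        GWA.C φ (z : R) ((φ ^ l)⁻¹ r) • GWA.x φ (z : R) ^ l • (rescale M hc m : M)
      rw [rescale_actC, coe_actC, ← mul_smul, GWA.x_pow_mul_C, mul_smul])
    (by
      intro r
      ext m
      change GWA.y φ (z : R) ^ l • GWA.C φ (z : R) r • (m : M) =
        GWA.C φ (z : R) ((φ ^ l) r) • GWA.y φ (z : R) ^ l • (m : M)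
      rw [← mul_smul, GWA.y_pow_mul_C, mul_smul])

/-- `M^{z^∞}` as an `H(R, φ ^ l, z)`-module. -/
@[reducible] def module (M : Type v) [AddCommGroup M] [Module (GWA φ (z : R)) M] (hl : 1 ≤ l)
    (h : IsNilpotent (Subring.centerCongr (φ ^ l) z - z))
    (hc : IsCoprime z (rescaling φ z l)) :
    Module (GWA (φ ^ l) (z : R)) (zTorsion φ z M) :=
  Module.compHom _ (action M hl h hc)

theorem x_locally_nilpotent (hl : 1 ≤ l)
    (h : IsNilpotent (Subring.centerCongr (φ ^ l) z - z))
    (hc : IsCoprime z (rescaling φ z l))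
    (hM : ∀ m : M, ∃ n : ℕ, GWA.x φ (z : R) ^ n • m = 0) (m : zTorsion φ z M) :
    ∃ n : ℕ, action M hl h hc (GWA.x (φ ^ l) (z : R) ^ n) m = 0 := by
  have key : ∀ (n : ℕ) (m : zTorsion φ z M), GWA.x φ (z : R) ^ (l * n) • (m : M) = 0 →
      ((xPow M h * rescale M hc) ^ n) m = 0 := by
    intro n
    induction n with
    | zero =>
      intro m hm
      exact Subtype.ext (by simpa using hm)
    | succ n ih =>
      intro m hm
      rw [pow_succ]
      refine ih _ ?_
      change GWA.x φ (z : R) ^ (l * n) • GWA.x φ (z : R) ^ l • (rescale M hc m : M) = 0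
      obtain ⟨k, hk⟩ := m.2
      obtain ⟨c, a, hca⟩ := exists_inverse hc k
      rw [rescale_eq hc hca m hk, ← mul_smul, ← pow_add, ← mul_smul, GWA.x_pow_mul_C, mul_smul,
        ← mul_add_one, hm, smul_zero]
  obtain ⟨n, hn⟩ := hM m
  refine ⟨n, ?_⟩
  rw [map_pow, action, GWA.lift_x]
  exact key n m (pow_smul_of_le hn (Nat.le_mul_of_pos_left n hl))

section map

variable {N : Type v} [AddCommGroup N] [Module (GWA φ (z : R)) N]

/-- The restriction of a homomorphism `M → N` to `M^{z^∞} → N^{z^∞}`. -/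
def map (f : M →ₗ[GWA φ (z : R)] N) : zTorsion φ z M →+ zTorsion φ z N where
  toFun m := ⟨f m, m.2.imp fun n hn => by rw [← map_smul, hn, map_zero]⟩
  map_zero' := Subtype.ext (map_zero f)
  map_add' _ _ := Subtype.ext (map_add f _ _)

theorem map_action (f : M →ₗ[GWA φ (z : R)] N) (hl : 1 ≤ l)
    (h : IsNilpotent (Subring.centerCongr (φ ^ l) z - z))
    (hc : IsCoprime z (rescaling φ z l)) (a : GWA (φ ^ l) (z : R)) (m : zTorsion φ z M) :
    map f (action M hl h hc a m) = action N hl h hc a (map f m) := by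
  induction a using GWA.induction generalizing m with
  | hC r =>
    rw [action, action, GWA.lift_C, GWA.lift_C]
    exact Subtype.ext (map_smul f _ _)
  | hx =>
    rw [action, action, GWA.lift_x, GWA.lift_x]
    obtain ⟨n, hn⟩ := m.2
    obtain ⟨c, a, hca⟩ := exists_inverse hc n
    apply Subtype.ext
    change f (GWA.x φ (z : R) ^ l • (rescale M hc m : M)) =
      GWA.x φ (z : R) ^ l • (rescale N hc (map f m) : N)
    rw [map_smul, rescale_eq hc hca m hn, rescale_eq hc hca (map f m) (by
      change _ • f m = 0
      rw [← map_smul, hn, map_zero]), map_smul]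
    rfl
  | hy =>
    rw [action, action, GWA.lift_y, GWA.lift_y]
    exact Subtype.ext (map_smul f _ _)
  | hadd a b ha hb => 
    rw [map_add, map_add]
    exact (map_add (map f) _ _).trans (congrArg₂ _ (ha m) (hb m))
  | hmul a b ha hb =>
    rw [map_mul, map_mul]
    exact (ha _).trans (congrArg _ (hb m))

end map

end zTorsion

/-- The functor `F : 𝒪(H(R, φ, z)) ⥤ 𝒪(H(R, φ ^ l, z))`, `F(M) = M^{z^∞}`. -/
def torsionFunctor (hl : 1 ≤ l) (h : IsNilpotent (Subring.centerCongr (φ ^ l) z - z))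
    (hcop : ∀ i, 1 ≤ i → i ≤ l - 1 → Ideal.span {z, Subring.centerCongr (φ ^ i) z} = ⊤) :
    CategoryO.{u, v} φ (z : R) ⥤ CategoryO.{u, v} (φ ^ l) (z : R) where
  obj M :=
    { obj :=
        letI := zTorsion.module M.obj hl h (zTorsion.isCoprime_rescaling hcop)
        ModuleCat.of (GWA (φ ^ l) (z : R)) (zTorsion φ z M.obj)
      property := zTorsion.x_locally_nilpotent hl h _ M.property }
  map {M N} f :=
    letI := zTorsion.module M.obj hl h (zTorsion.isCoprime_rescaling hcop)
    letI := zTorsion.module N.obj hl h (zTorsion.isCoprime_rescaling hcop)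
    ObjectProperty.homMk (ModuleCat.ofHom
      { toFun := zTorsion.map f.hom.hom
        map_add' := map_add _
        map_smul' := zTorsion.map_action f.hom.hom hl h _ })

theorem isNilpotent_of_dvd {b : Subring.center R} (hb : IsNilpotent b)
    (hz : (b : R) ∣ (φ ^ l) (z : R) - z) : IsNilpotent (Subring.centerCongr (φ ^ l) z - z) := by
  obtain ⟨n, hn⟩ := hb
  obtain ⟨a, ha⟩ := hz
  refine ⟨n, Subtype.ext ?_⟩
  change ((φ ^ l) (z : R) - z) ^ n = 0
  have h : Commute (b : R) a := (Subring.mem_center_iff.mp b.2 a).symm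
  rw [ha, h.mul_pow, ← SubmonoidClass.coe_pow, hn, Subring.coe_zero, zero_mul]

end Torsion

end

noncomputable section

/-! ### Coprimality and nilpotents in the center. -/

section CommRing

/-! Write l = k + 1 and zᵢ = φⁱ(z). The functor is inverted by induction: every M in 𝒪(H(R, φ, z))
is the direct sum of the yⁱ M^{z^∞}, 0 ≤ i ≤ k, with each yⁱ injective on M^{z^∞}, so M is recovered
from the H(R, φ^l, z)-module M^{z^∞}.

The decomposition is a Chinese remainder argument. The element w = z₀z₁⋯z_k equals y^l x^l and is
fixed by φ^l up to a nilpotent, so local nilpotence of x forces w to be locally nilpotent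
(`exists_prod_pow_smul_eq_zero`). Since z₀, …, z_k are pairwise coprime, M splits into the torsion
parts for the zᵢ. The map yⁱ carries z-torsion to zᵢ-torsion, and it is bijective there: yⁱxⁱ =
z₀⋯zᵢ₋₁ is coprime to zᵢ, and xⁱyⁱ = φ⁻ⁱ(z₀⋯zᵢ₋₁) is coprime to z (`exists_y_pow_smul_eq`,
`eq_zero_of_y_pow_smul_eq_zero`). Together these give `IsInducing.lift_injective` and
`IsInducing.lift_surjective`.

Conversely, for N in 𝒪(H(R, φ^l, z)) the group ⨁ yⁱN carries an action of H(R, φ, z). There z acts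
on yⁱN through φ⁻ⁱ(z), which is coprime to z when 1 ≤ i ≤ k, while z is locally nilpotent on N.
Hence the z-torsion is exactly y⁰N (`InducedModule.exists_single_eq`), which gives essential
surjectivity. Full faithfulness follows from the universal property of the induced module
(`IsInducing.lift`).

For the last assertion N = M^{z^∞} works: every element of R_φ[y] ⊗ N is a sum of terms yⁱ ⊗ nᵢ with
i ≤ k, and the decomposition of M makes the map to M bijective on such sums. -/

theorem IsCoprime.smul_eq_zero {S A M : Type*} [CommRing S] [Ring A] [AddCommGroup M] [Module A M]
    (f : S →+* A) {s t : S} (h : IsCoprime s t) {m : M} (hs : f s • m = 0) (ht : f t • m = 0) :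
    m = 0 := by
  obtain ⟨a, b, hab⟩ := h
  rw [← one_smul A m, ← map_one f, ← hab, map_add, map_mul, map_mul, add_smul, mul_smul, mul_smul,
    hs, ht, smul_zero, smul_zero, add_zero]

/-- Both products agree in the quotient by the nilradical, because their factors do. -/
theorem IsNilpotent.prod_sub_prod {S ι : Type*} [CommRing S] (s : Finset ι) (f g : ι → S)
    (h : ∀ i ∈ s, IsNilpotent (f i - g i)) : IsNilpotent (∏ i ∈ s, f i - ∏ i ∈ s, g i) := by
  rw [← mem_nilradical, ← Ideal.Quotient.eq, map_prod, map_prod]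
  exact Finset.prod_congr rfl fun i hi => Ideal.Quotient.eq.mpr (mem_nilradical.mpr (h i hi))

end CommRing

section Center

variable {R : Type u} [Ring R]

/-- The structure map of `H(R, φ, z)` restricted to the center of `R`. -/
def GWA.ofCenter (φ : RingAut R) (z : R) : Subring.center R →+* GWA φ z :=
  (GWA.C φ z).comp (Subring.center R).subtype

theorem GWA.ofCenter_apply (φ : RingAut R) (z : R) (w : Subring.center R) :
    GWA.ofCenter φ z w = GWA.C φ z (w : R) := rfl

theorem GWA.y_pow_mul_ofCenter (φ : RingAut R) (z : R) (n : ℕ) (w : Subring.center R) :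
    GWA.y φ z ^ n * GWA.ofCenter φ z w =
      GWA.ofCenter φ z (Subring.centerCongr (φ ^ n) w) * GWA.y φ z ^ n :=
  GWA.y_pow_mul_C φ z n w

theorem GWA.x_pow_mul_ofCenter (φ : RingAut R) (z : R) (n : ℕ) (w : Subring.center R) :
    GWA.x φ z ^ n * GWA.ofCenter φ z w =
      GWA.ofCenter φ z (Subring.centerCongr (φ ^ n)⁻¹ w) * GWA.x φ z ^ n :=
  GWA.x_pow_mul_C φ z n w

theorem Subring.centerCongr_mul (ψ χ : RingAut R) (w : Subring.center R) :
    Subring.centerCongr (ψ * χ) w = Subring.centerCongr ψ (Subring.centerCongr χ w) := rfl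

theorem Subring.centerCongr_one (w : Subring.center R) :
    Subring.centerCongr (1 : RingAut R) w = w := rfl

variable {φ : RingAut R} {z : Subring.center R} {k : ℕ}

/-- Apply φⁱ to the coprimality of z and φ^(j-i)(z). -/
theorem Subring.isCoprime_centerCongr_pow
    (hcop : ∀ i, 1 ≤ i → i ≤ k → IsCoprime z (Subring.centerCongr (φ ^ i) z)) {i j : ℕ}
    (hij : i < j) (hj : j ≤ k) :
    IsCoprime (Subring.centerCongr (φ ^ i) z) (Subring.centerCongr (φ ^ j) z) := by
  have h := (hcop (j - i) (by omega) (by omega)).map (Subring.centerCongr (φ ^ i)).toRingHom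
  change IsCoprime _ (Subring.centerCongr (φ ^ i) (Subring.centerCongr (φ ^ (j - i)) z)) at h
  rwa [← Subring.centerCongr_mul, ← pow_add, Nat.add_sub_cancel' hij.le] at h

theorem Subring.isCoprime_centerCongr_inv
    (hcop : ∀ i, 1 ≤ i → i ≤ k → IsCoprime z (Subring.centerCongr (φ ^ i) z)) {i : ℕ}
    (hi : 1 ≤ i) (hik : i ≤ k) : IsCoprime z (Subring.centerCongr (φ ^ i)⁻¹ z) := by
  have h := (hcop i hi hik).map (Subring.centerCongr (φ ^ i)⁻¹).toRingHom
  change IsCoprime _ (Subring.centerCongr (φ ^ i)⁻¹ (Subring.centerCongr (φ ^ i) z)) at h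
  rw [← Subring.centerCongr_mul, inv_mul_cancel] at h
  exact h.symm

theorem Subring.isCoprime_centerCongr_prod
    (hcop : ∀ i, 1 ≤ i → i ≤ k → IsCoprime z (Subring.centerCongr (φ ^ i) z)) {j : ℕ}
    (hj : j ≤ k) : IsCoprime (Subring.centerCongr (φ ^ j) z)
      (∏ i ∈ Finset.range j, Subring.centerCongr (φ ^ i) z) :=
  IsCoprime.prod_right fun _ hi =>
    (Subring.isCoprime_centerCongr_pow hcop (Finset.mem_range.mp hi) hj).symm

theorem Subring.pairwise_isCoprime_centerCongr_pow
    (hcop : ∀ i, 1 ≤ i → i ≤ k → IsCoprime z (Subring.centerCongr (φ ^ i) z)) (n : ℕ) :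
    Pairwise (Function.onFun IsCoprime
      fun i : Fin (k + 1) => Subring.centerCongr (φ ^ (i : ℕ)) z ^ n) := by
  intro i j hij
  rcases lt_or_gt_of_ne (Fin.val_ne_of_ne hij) with h | h
  · exact (Subring.isCoprime_centerCongr_pow hcop h (by omega)).pow
  · exact (Subring.isCoprime_centerCongr_pow hcop h (by omega)).symm.pow

end Center

section RingAut

variable {R : Type u} [Ring R] (φ : RingAut R)

theorem RingAut.inv_pow_succ_apply (n : ℕ) (r : R) :
    (φ ^ (n + 1))⁻¹ r = (φ ^ n)⁻¹ (φ⁻¹ r) := by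
  rw [pow_succ', mul_inv_rev]
  rfl

theorem RingAut.pow_succ_inv_pow_apply (n : ℕ) (r : R) :
    (φ ^ (n + 1)) ((φ ^ n)⁻¹ r) = φ r := by
  rw [← RingAut.mul_apply, pow_succ', mul_inv_cancel_right]

end RingAut

/-! ### The induced module -/

/-- The module `⨁ yⁱ N`, `0 ≤ i ≤ k`, over `H(R, φ, z)` induced from a module `N` over
`H(R, φ ^ (k + 1), z)`; the component `yⁱ n` is the `i`-th coordinate. -/
def InducedModule {R : Type u} [Ring R] (_φ : RingAut R) (_z : Subring.center R) (k : ℕ)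
    (N : Type v) : Type v :=
  Fin (k + 1) → N

namespace InducedModule

variable {R : Type u} [Ring R] {φ : RingAut R} {z : Subring.center R} {k : ℕ}

@[ext] theorem ext {N : Type v} {f g : InducedModule φ z k N} (h : ∀ i, f i = g i) : f = g :=
  funext h

variable {N : Type v} [AddCommGroup N]

instance : AddCommGroup (InducedModule φ z k N) := inferInstanceAs (AddCommGroup (Fin (k + 1) → N))

theorem add_apply (f g : InducedModule φ z k N) (i : Fin (k + 1)) : (f + g) i = f i + g i := rfl

/-- The inclusion of the `i`-th summand `yⁱ N`. -/
def single (φ : RingAut R) (z : Subring.center R) {k : ℕ} {N : Type v} [AddCommGroup N]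
    (i : Fin (k + 1)) : N →+ InducedModule φ z k N :=
  AddMonoidHom.single (fun _ : Fin (k + 1) => N) i

theorem single_same (i : Fin (k + 1)) (n : N) : single φ z i n i = n :=
  Pi.single_eq_same (M := fun _ : Fin (k + 1) => N) i n

theorem single_ne {i j : Fin (k + 1)} (h : j ≠ i) (n : N) : single φ z i n j = 0 :=
  Pi.single_eq_of_ne (M := fun _ : Fin (k + 1) => N) h n

theorem sum_single (f : InducedModule φ z k N) : ∑ i, single φ z i (f i) = f :=
  Finset.univ_sum_single (M := fun _ : Fin (k + 1) => N) f

variable [Module (GWA (φ ^ (k + 1)) z) N]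

/-- The action of `R` on `⨁ yⁱ N`. -/
def actC (φ : RingAut R) (z : Subring.center R) (k : ℕ) (N : Type v) [AddCommGroup N]
    [Module (GWA (φ ^ (k + 1)) z) N] : R →+* AddMonoid.End (InducedModule φ z k N) where
  toFun r :=
    -- Forced by r yⁱ = yⁱ φ⁻ⁱ(r).
    { toFun := fun f i => GWA.C (φ ^ (k + 1)) z ((φ ^ (i : ℕ))⁻¹ r) • f i
      map_zero' := funext fun _ => smul_zero _
      map_add' := fun _ _ => funext fun _ => smul_add _ _ _ }
  map_one' := AddMonoidHom.ext fun f => funext fun i => by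
    change GWA.C (φ ^ (k + 1)) z ((φ ^ (i : ℕ))⁻¹ 1) • f i = f i
    rw [map_one, map_one, one_smul]
  map_zero' := AddMonoidHom.ext fun f => funext fun i => by
    change GWA.C (φ ^ (k + 1)) z ((φ ^ (i : ℕ))⁻¹ 0) • f i = 0
    rw [map_zero, map_zero, zero_smul]
  map_mul' r s := AddMonoidHom.ext fun f => funext fun i => by
    change GWA.C (φ ^ (k + 1)) z ((φ ^ (i : ℕ))⁻¹ (r * s)) • f i =
      GWA.C (φ ^ (k + 1)) z ((φ ^ (i : ℕ))⁻¹ r) • GWA.C (φ ^ (k + 1)) z ((φ ^ (i : ℕ))⁻¹ s) • f i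
    rw [map_mul, map_mul, mul_smul]
  map_add' r s := AddMonoidHom.ext fun f => funext fun i => by
    change GWA.C (φ ^ (k + 1)) z ((φ ^ (i : ℕ))⁻¹ (r + s)) • f i =
      GWA.C (φ ^ (k + 1)) z ((φ ^ (i : ℕ))⁻¹ r) • f i +
        GWA.C (φ ^ (k + 1)) z ((φ ^ (i : ℕ))⁻¹ s) • f i
    rw [map_add, map_add, add_smul]

/-- The action of `y` on `⨁ yⁱ N`. -/
def actY (φ : RingAut R) (z : Subring.center R) (k : ℕ) (N : Type v) [AddCommGroup N]
    [Module (GWA (φ ^ (k + 1)) z) N] : AddMonoid.End (InducedModule φ z k N) where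
  -- Multiplication by y shifts the summands; y · yᵏn = y^(k+1) n wraps around to degree 0, where
  -- y^(k+1) is the generator y of the smaller algebra.
  toFun f := Fin.cons (α := fun _ => N) (GWA.y (φ ^ (k + 1)) z • f (Fin.last k))
    fun i : Fin k => f i.castSucc
  map_zero' := funext fun i => by
    cases i using Fin.cases with
    | zero => exact smul_zero _
    | succ i => rfl
  map_add' f g := funext fun i => by
    cases i using Fin.cases with
    | zero => exact smul_add _ _ _
    | succ i => rfl

/-- Multiplication by `x` on `⨁ yⁱ N`. -/
def xMul (f : InducedModule φ z k N) : InducedModule φ z k N :=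
  Fin.snoc (α := fun _ => N)
    -- Forced by x y^(i+1) n = φ⁻¹(z) yⁱ n = yⁱ φ^(-(i+1))(z) n.
    (fun i : Fin k => GWA.C (φ ^ (k + 1)) z ((φ ^ ((i : ℕ) + 1))⁻¹ z) • f i.succ)
    -- In degree 0 the product goes to degree k: a further y then wraps around and gives yx = z on
    -- N.
    (GWA.x (φ ^ (k + 1)) z • f 0)

theorem xMul_last (f : InducedModule φ z k N) :
    xMul f (Fin.last k) = GWA.x (φ ^ (k + 1)) z • f 0 := by
  unfold xMul
  exact Fin.snoc_last (α := fun _ => N) _ _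

theorem xMul_castSucc (f : InducedModule φ z k N) (i : Fin k) :
    xMul f i.castSucc = GWA.C (φ ^ (k + 1)) z ((φ ^ ((i : ℕ) + 1))⁻¹ z) • f i.succ := by
  unfold xMul
  exact Fin.snoc_castSucc (α := fun _ => N) _ _ _

/-- The action of `x` on `⨁ yⁱ N`. -/
def actX (φ : RingAut R) (z : Subring.center R) (k : ℕ) (N : Type v) [AddCommGroup N]
    [Module (GWA (φ ^ (k + 1)) z) N] : AddMonoid.End (InducedModule φ z k N) where
  toFun := xMul
  map_zero' := ext fun i => by
    cases i using Fin.lastCases with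
    | last => exact (xMul_last _).trans (smul_zero _)
    | cast i => exact (xMul_castSucc _ _).trans (smul_zero _)
  map_add' f g := ext fun i => by
    rw [add_apply]
    cases i using Fin.lastCases with
    | last => rw [xMul_last, xMul_last, xMul_last, add_apply, smul_add]
    | cast i => rw [xMul_castSucc, xMul_castSucc, xMul_castSucc, add_apply, smul_add]

theorem actC_apply (r : R) (f : InducedModule φ z k N) (i : Fin (k + 1)) :
    actC φ z k N r f i = GWA.C (φ ^ (k + 1)) z ((φ ^ (i : ℕ))⁻¹ r) • f i := rfl

theorem actY_zero (f : InducedModule φ z k N) :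
    actY φ z k N f 0 = GWA.y (φ ^ (k + 1)) z • f (Fin.last k) := rfl

theorem actY_succ (f : InducedModule φ z k N) (i : Fin k) :
    actY φ z k N f i.succ = f i.castSucc := rfl

theorem actX_last (f : InducedModule φ z k N) :
    actX φ z k N f (Fin.last k) = GWA.x (φ ^ (k + 1)) z • f 0 := xMul_last f

theorem actX_castSucc (f : InducedModule φ z k N) (i : Fin k) :
    actX φ z k N f i.castSucc = GWA.C (φ ^ (k + 1)) z ((φ ^ ((i : ℕ) + 1))⁻¹ z) • f i.succ :=
  xMul_castSucc f i

/-- The action of `H(R, φ, z)` on `⨁ yⁱ N`. -/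
def action (φ : RingAut R) (z : Subring.center R) (k : ℕ) (N : Type v)
    [AddCommGroup N] [Module (GWA (φ ^ (k + 1)) z) N] :
    GWA φ z →+* AddMonoid.End (InducedModule φ z k N) :=
  GWA.lift (actC φ z k N) (actX φ z k N) (actY φ z k N)
    (by
      ext f i
      change actY φ z k N (actX φ z k N f) i = _
      cases i using Fin.cases with
      | zero =>
        rw [actY_zero, actX_last, actC_apply, ← mul_smul, GWA.y_mul_x]
        rfl
      | succ i =>
        rw [actY_succ, actX_castSucc, actC_apply]
        rfl)
    (by
      ext f i
      change actX φ z k N (actY φ z k N f) i = _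
      cases i using Fin.lastCases with
      | last =>
        rw [actX_last, actY_zero, actC_apply, ← mul_smul, GWA.x_mul_y,
          RingAut.inv_pow_succ_apply φ k]
        rfl
      | cast i =>
        rw [actX_castSucc, actY_succ, actC_apply, RingAut.inv_pow_succ_apply φ i]
        rfl)
    (by
      intro r
      ext f i
      change actX φ z k N (actC φ z k N r f) i = actC φ z k N (φ⁻¹ r) (actX φ z k N f) i
      cases i using Fin.lastCases with
      | last =>
        rw [actX_last, actC_apply, actC_apply, actX_last, ← mul_smul, GWA.x_mul_C,
          RingAut.inv_pow_succ_apply φ k, mul_smul]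
        rfl
      | cast i =>
        rw [actX_castSucc, actC_apply, actC_apply, actX_castSucc, Fin.val_succ, Fin.val_castSucc,
          ← mul_smul, ← mul_smul, ← map_mul, ← map_mul, ← RingAut.inv_pow_succ_apply φ i r,
          ← map_mul, ← map_mul, Subring.mem_center_iff.mp z.2 r])
    (by
      intro r
      ext f i
      change actY φ z k N (actC φ z k N r f) i = actC φ z k N (φ r) (actY φ z k N f) i
      cases i using Fin.cases with
      | zero =>
        rw [actY_zero, actC_apply, actC_apply, actY_zero, ← mul_smul, ← mul_smul, GWA.y_mul_C,
          Fin.val_last, RingAut.pow_succ_inv_pow_apply]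
        rfl
      | succ i =>
        rw [actY_succ, actC_apply, actC_apply, actY_succ, Fin.val_succ,
          RingAut.inv_pow_succ_apply φ i, ← RingAut.mul_apply φ⁻¹, inv_mul_cancel]
        rfl)

instance : Module (GWA φ (z : R)) (InducedModule φ z k N) := Module.compHom _ (action φ z k N)

theorem C_smul_apply (r : R) (f : InducedModule φ z k N) (i : Fin (k + 1)) :
    (GWA.C φ (z : R) r • f) i = GWA.C (φ ^ (k + 1)) (z : R) ((φ ^ (i : ℕ))⁻¹ r) • f i :=
  congrArg (fun g : AddMonoid.End (InducedModule φ z k N) => g f i) (GWA.lift_C ..)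

theorem y_smul (f : InducedModule φ z k N) : GWA.y φ (z : R) • f = actY φ z k N f :=
  congrArg (fun g : AddMonoid.End (InducedModule φ z k N) => g f) (GWA.lift_y ..)

theorem x_smul (f : InducedModule φ z k N) : GWA.x φ (z : R) • f = actX φ z k N f :=
  congrArg (fun g : AddMonoid.End (InducedModule φ z k N) => g f) (GWA.lift_x ..)

theorem C_smul_single (r : R) (i : Fin (k + 1)) (n : N) :
    GWA.C φ (z : R) r • single φ z i n =
      single φ z i (GWA.C (φ ^ (k + 1)) (z : R) ((φ ^ (i : ℕ))⁻¹ r) • n) := by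
  ext j
  rw [C_smul_apply]
  by_cases h : j = i
  · subst h
    rw [single_same, single_same]
  · rw [single_ne h, single_ne h, smul_zero]

theorem y_smul_single_castSucc (i : Fin k) (n : N) :
    GWA.y φ (z : R) • single φ z i.castSucc n = single φ z i.succ n := by
  rw [y_smul]
  ext j
  cases j using Fin.cases with
  | zero =>
    rw [actY_zero, single_ne (Fin.succ_ne_zero i).symm, single_ne (Fin.castSucc_ne_last i).symm,
      smul_zero]
  | succ j =>
    rw [actY_succ]
    by_cases h : j = i
    · subst h
      rw [single_same, single_same]
    · rw [single_ne (by simpa using h), single_ne (by simpa using h)]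

theorem y_smul_single_last (n : N) :
    GWA.y φ (z : R) • single φ z (Fin.last k) n =
      single φ z 0 (GWA.y (φ ^ (k + 1)) (z : R) • n) := by
  rw [y_smul]
  ext j
  cases j using Fin.cases with
  | zero => rw [actY_zero, single_same, single_same]
  | succ j => rw [actY_succ, single_ne (Fin.castSucc_ne_last j), single_ne (Fin.succ_ne_zero j)]

theorem x_smul_single_zero (n : N) :
    GWA.x φ (z : R) • single φ z 0 n =
      single φ z (Fin.last k) (GWA.x (φ ^ (k + 1)) (z : R) • n) := by
  rw [x_smul]
  ext j
  cases j using Fin.lastCases with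
  | last => rw [actX_last, single_same, single_same]
  | cast j =>
    rw [actX_castSucc, single_ne (Fin.castSucc_ne_last j), single_ne (Fin.succ_ne_zero j),
      smul_zero]

theorem x_smul_single_succ (i : Fin k) (n : N) :
    GWA.x φ (z : R) • single φ z i.succ n = single φ z i.castSucc
      (GWA.C (φ ^ (k + 1)) (z : R) ((φ ^ ((i : ℕ) + 1))⁻¹ z) • n) := by
  rw [x_smul]
  ext j
  cases j using Fin.lastCases with
  | last =>
    rw [actX_last, single_ne (Fin.castSucc_ne_last i).symm, single_ne (Fin.succ_ne_zero i).symm,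
      smul_zero]
  | cast j =>
    rw [actX_castSucc]
    by_cases h : j = i
    · subst h
      rw [single_same, single_same]
    · rw [single_ne (by simpa using h), single_ne (by simpa using h), smul_zero]

theorem y_pow_smul_single_zero (i : Fin (k + 1)) (n : N) :
    GWA.y φ (z : R) ^ (i : ℕ) • single φ z 0 n = single φ z i n := by
  induction i using Fin.induction with
  | zero => rw [Fin.val_zero, pow_zero, one_smul]
  | succ i ih =>
    rw [Fin.val_succ, pow_succ', mul_smul]
    exact (congrArg _ ih).trans (y_smul_single_castSucc i n)

theorem y_pow_succ_smul_single_zero (n : N) :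
    GWA.y φ (z : R) ^ (k + 1) • single φ z (k := k) 0 n =
      single φ z 0 (GWA.y (φ ^ (k + 1)) (z : R) • n) := by
  rw [pow_succ', mul_smul]
  exact (congrArg _ (y_pow_smul_single_zero (Fin.last k) n)).trans (y_smul_single_last n)

end InducedModule

/-! ### Maps compatible with induction, and the universal property. -/

section

variable {R : Type u} [Ring R] {φ : RingAut R} {z : Subring.center R} {k : ℕ}

/-- A map `ι : N → M` from an `H(R, φ ^ (k + 1), z)`-module to an `H(R, φ, z)`-module which is
compatible with the inclusion of `N` in the induced module as the summand `y⁰ N`. -/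
structure IsInducing {N M : Type*} [AddCommGroup N] [Module (GWA (φ ^ (k + 1)) (z : R)) N]
    [AddCommGroup M] [Module (GWA φ (z : R)) M] (ι : N →+ M) : Prop where
  map_C (r : R) (n : N) : ι (GWA.C (φ ^ (k + 1)) (z : R) r • n) = GWA.C φ (z : R) r • ι n
  map_y (n : N) : ι (GWA.y (φ ^ (k + 1)) (z : R) • n) = GWA.y φ (z : R) ^ (k + 1) • ι n
  -- This form needs no inverse of Φ. On M^{z^∞}, where x acts as x^(k+1) Φ⁻¹, it amounts to yᵏ
  -- x^(k+1) = x Φ.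
  map_x (n : N) : GWA.y φ (z : R) ^ k • ι (GWA.x (φ ^ (k + 1)) (z : R) • n) = GWA.x φ (z : R) • ι n

namespace IsInducing

variable {N M : Type v} [AddCommGroup N] [AddCommGroup M] [Module (GWA φ (z : R)) M]
  {ι : N →+ M}

/-- The additive map `⨁ yⁱ N → M`, `yⁱ n ↦ yⁱ ι(n)`. -/
def sumHom (φ : RingAut R) (z : Subring.center R) (k : ℕ) {N M : Type v} [AddCommGroup N]
    [AddCommGroup M] [Module (GWA φ (z : R)) M] (ι : N →+ M) : InducedModule φ z k N →+ M where
  toFun f := ∑ i : Fin (k + 1), GWA.y φ (z : R) ^ (i : ℕ) • ι (f i)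
  map_zero' := Finset.sum_eq_zero fun i _ => (congrArg _ (map_zero ι)).trans (smul_zero _)
  map_add' f g := by
    rw [← Finset.sum_add_distrib]
    refine Finset.sum_congr rfl fun i _ => ?_
    rw [InducedModule.add_apply, map_add, smul_add]

theorem sumHom_single (i : Fin (k + 1)) (n : N) :
    sumHom φ z k ι (InducedModule.single φ z i n) = GWA.y φ (z : R) ^ (i : ℕ) • ι n := by
  refine (Finset.sum_eq_single i (fun j _ h => ?_) (fun h => absurd (Finset.mem_univ i) h)).trans ?_
  · rw [InducedModule.single_ne h, map_zero, smul_zero]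
  · rw [InducedModule.single_same]

variable [Module (GWA (φ ^ (k + 1)) (z : R)) N]

theorem single : IsInducing (φ := φ) (z := z) (k := k) (InducedModule.single φ z (k := k) (N := N) 0) where
  map_C r n := by
    rw [InducedModule.C_smul_single]
    rfl
  map_y n := (InducedModule.y_pow_succ_smul_single_zero n).symm
  map_x n := by
    rw [InducedModule.x_smul_single_zero]
    exact InducedModule.y_pow_smul_single_zero (Fin.last k) _

/-- Generators are checked summand by summand. The wrap-around cases y · yᵏn and x · y⁰n are `map_y`
and `map_x`; the others need at most `map_C` and the defining relations of H(R, φ, z). -/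
theorem sumHom_map_smul (h : IsInducing (φ := φ) (z := z) (k := k) ι) (a : GWA φ (z : R))
    (f : InducedModule φ z k N) : sumHom φ z k ι (a • f) = a • sumHom φ z k ι f := by
  induction a using GWA.induction generalizing f with
  | hadd a b ha hb => rw [add_smul, map_add, ha, hb, add_smul]
  | hmul a b ha hb => rw [mul_smul, ha, hb, mul_smul]
  | hC r =>
    rw [← InducedModule.sum_single f, Finset.smul_sum, map_sum, map_sum, Finset.smul_sum]
    refine Finset.sum_congr rfl fun i _ => ?_
    rw [InducedModule.C_smul_single, sumHom_single, sumHom_single, h.map_C, ← mul_smul, ← mul_smul,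
      GWA.y_pow_mul_C, ← RingAut.mul_apply, mul_inv_cancel, RingAut.one_apply]
  | hy =>
    rw [← InducedModule.sum_single f, Finset.smul_sum, map_sum, map_sum, Finset.smul_sum]
    refine Finset.sum_congr rfl fun i _ => ?_
    cases i using Fin.lastCases with
    | last =>
      rw [InducedModule.y_smul_single_last, sumHom_single, sumHom_single, h.map_y, ← mul_smul,
        ← mul_smul, Fin.val_last, ← pow_succ', Fin.val_zero, pow_zero, one_mul]
    | cast i =>
      rw [InducedModule.y_smul_single_castSucc, sumHom_single, sumHom_single, ← mul_smul,
        ← pow_succ']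
      rfl
  | hx =>
    rw [← InducedModule.sum_single f, Finset.smul_sum, map_sum, map_sum, Finset.smul_sum]
    refine Finset.sum_congr rfl fun i _ => ?_
    cases i using Fin.cases with
    | zero =>
      rw [InducedModule.x_smul_single_zero, sumHom_single, sumHom_single, Fin.val_last, h.map_x,
        Fin.val_zero, pow_zero, one_smul]
    | succ i =>
      rw [InducedModule.x_smul_single_succ, sumHom_single, sumHom_single, h.map_C, ← mul_smul,
        ← mul_smul, GWA.y_pow_mul_C, Fin.val_succ, pow_succ' (GWA.y φ (z : R)), ← mul_assoc,
        GWA.x_mul_y, RingAut.inv_pow_succ_apply, ← RingAut.mul_apply (φ ^ _), Fin.val_castSucc,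
        mul_inv_cancel, RingAut.one_apply]

/-- The universal property of the induced module. -/
def lift (h : IsInducing (φ := φ) (z := z) (k := k) ι) :
    InducedModule φ z k N →ₗ[GWA φ (z : R)] M :=
  { sumHom φ z k ι with map_smul' := h.sumHom_map_smul }

theorem lift_single (h : IsInducing (φ := φ) (z := z) (k := k) ι) (i : Fin (k + 1)) (n : N) :
    h.lift (InducedModule.single φ z i n) = GWA.y φ (z : R) ^ (i : ℕ) • ι n :=
  sumHom_single i n

theorem lift_apply (h : IsInducing (φ := φ) (z := z) (k := k) ι) (f : InducedModule φ z k N) :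
    h.lift f = ∑ i : Fin (k + 1), GWA.y φ (z : R) ^ (i : ℕ) • ι (f i) :=
  rfl

end IsInducing

end

/-! ### Torsion and the decomposition M = ⨁ yⁱ M^{z^∞}. -/

section

variable {R : Type u} [Ring R] {φ : RingAut R} {z : Subring.center R} {k : ℕ}

/-- This writes Φ as φ(yᵏxᵏ), the form in which Φ cancels when it is moved past x. -/
theorem rescaling_succ (φ : RingAut R) (z : Subring.center R) (k : ℕ) : rescaling φ z (k + 1) =
    Subring.centerCongr φ (∏ i ∈ Finset.range k, Subring.centerCongr (φ ^ i) z) := by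
  rw [rescaling, map_prod, Finset.prod_Ico_eq_prod_range, Nat.add_sub_cancel]
  refine Finset.prod_congr rfl fun i _ => ?_
  rw [← Subring.centerCongr_mul, add_comm 1 i, pow_succ']

section Torsion

variable {M : Type v} [AddCommGroup M] [Module (GWA φ (z : R)) M]

/-- Induction on n: if wᵗ kills x^l m, applying y^l shows that φ^l(w)ᵗ kills y^l x^l m = w m. As w
and φ^l(w) differ by a nilpotent, a power of w kills w m, hence a larger one kills m. -/
theorem exists_prod_pow_smul_eq_zero {l : ℕ}
    (h : IsNilpotent (Subring.centerCongr (φ ^ l) z - z)) (n : ℕ) {m : M}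
    (hm : GWA.x φ (z : R) ^ (l * n) • m = 0) :
    ∃ t : ℕ, GWA.C φ (z : R)
      (∏ i ∈ Finset.range l, Subring.centerCongr (φ ^ i) z : Subring.center R) ^ t • m = 0 := by
  set w : Subring.center R := ∏ i ∈ Finset.range l, Subring.centerCongr (φ ^ i) z with hw
  -- Each factor satisfies φ^l(φⁱ(z)) - φⁱ(z) = φⁱ(φ^l(z) - z), which is nilpotent.
  have hnil : IsNilpotent (w - Subring.centerCongr (φ ^ l) w) := by
    rw [hw, map_prod]
    refine IsNilpotent.prod_sub_prod _ _ _ fun i _ => ?_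
    rw [← Subring.centerCongr_mul, (Commute.refl φ).pow_pow l i, Subring.centerCongr_mul,
      ← map_sub, ← neg_sub, map_neg, isNilpotent_neg_iff]
    exact h.map (Subring.centerCongr (φ ^ i))
  induction n generalizing m with
  | zero => exact ⟨0, by simpa using hm⟩
  | succ n ih =>
    rw [Nat.mul_succ, pow_add, mul_smul] at hm
    obtain ⟨t, ht⟩ := ih hm
    have h1 := congrArg (GWA.y φ (z : R) ^ l • ·) ht
    simp only [smul_zero] at h1
    rw [← map_pow, ← mul_smul, GWA.y_pow_mul_C, mul_smul, ← mul_smul (GWA.y φ (z : R) ^ l),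
      zTorsion.y_pow_mul_x_pow, ← hw, map_pow, map_pow] at h1
    obtain ⟨s, hs⟩ := zTorsion.exists_pow_smul hnil ⟨t, h1⟩
    exact ⟨s + 1, by rw [pow_succ, mul_smul, hs]⟩

/-- The case l = 1. Used with φ ^ (k + 1) in place of φ, it shows that z is locally nilpotent on
every object of the target category. -/
theorem exists_pow_smul_eq_zero (h : IsNilpotent (Subring.centerCongr φ z - z)) {m : M}
    (hm : ∃ n : ℕ, GWA.x φ (z : R) ^ n • m = 0) :
    ∃ t : ℕ, GWA.C φ (z : R) (z : R) ^ t • m = 0 := by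
  obtain ⟨n, hn⟩ := hm
  obtain ⟨t, ht⟩ := exists_prod_pow_smul_eq_zero (φ := φ) (l := 1) (m := m)
    (by rwa [pow_one]) n (by rwa [one_mul])
  rw [Finset.prod_range_one, pow_zero, Subring.centerCongr_one] at ht
  exact ⟨t, ht⟩

theorem exists_y_pow_smul_eq
    (hcop : ∀ i, 1 ≤ i → i ≤ k → IsCoprime z (Subring.centerCongr (φ ^ i) z)) {i t : ℕ}
    (hi : i ≤ k) {w : M} (hw : GWA.ofCenter φ (z : R) (Subring.centerCongr (φ ^ i) z ^ t) • w = 0) :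
    ∃ m ∈ zTorsion φ z M, GWA.y φ (z : R) ^ i • m = w := by
  -- From a zᵢᵗ + c z₀⋯zᵢ₋₁ = 1, the element c inverts yⁱxⁱ on w. So c yⁱxⁱ w = w, and moving c past
  -- yⁱ turns it into φ⁻ⁱ(c) in the preimage.
  obtain ⟨a, c, hac⟩ := (Subring.isCoprime_centerCongr_prod hcop hi).pow_left (m := t)
  refine ⟨GWA.ofCenter φ (z : R) (Subring.centerCongr (φ ^ i)⁻¹ c) • GWA.x φ (z : R) ^ i • w,
    zTorsion.C_smul_mem _ ⟨t, ?_⟩, ?_⟩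
  · have h1 := congrArg (GWA.x φ (z : R) ^ i • ·) hw
    simp only [smul_zero] at h1
    rw [← mul_smul, GWA.x_pow_mul_ofCenter, map_pow (Subring.centerCongr _),
      ← Subring.centerCongr_mul, inv_mul_cancel, Subring.centerCongr_one, mul_smul, map_pow] at h1
    exact h1
  · rw [← mul_smul, GWA.y_pow_mul_ofCenter, ← Subring.centerCongr_mul, mul_inv_cancel,
      Subring.centerCongr_one, mul_smul, ← mul_smul (_ ^ i), zTorsion.y_pow_mul_x_pow,
      ← GWA.ofCenter_apply, ← mul_smul, ← map_mul]
    have h2 : (GWA.ofCenter φ (z : R) 1) • w = w := by rw [map_one, one_smul]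
    rw [← hac, map_add, add_smul, map_mul, mul_smul, hw, smul_zero, zero_add] at h2
    exact h2

theorem eq_zero_of_y_pow_smul_eq_zero
    (hcop : ∀ i, 1 ≤ i → i ≤ k → IsCoprime z (Subring.centerCongr (φ ^ i) z)) {i : ℕ}
    (hi : i ≤ k) {m : M} (hm : m ∈ zTorsion φ z M) (h : GWA.y φ (z : R) ^ i • m = 0) : m = 0 := by
  obtain ⟨t, ht⟩ := hm
  -- Applying φ⁻ⁱ makes z coprime to φ⁻ⁱ(z₀⋯zᵢ₋₁) = xⁱyⁱ. The latter kills m because yⁱ does.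
  have hc := (Subring.isCoprime_centerCongr_prod hcop hi).map
    (Subring.centerCongr (φ ^ i)⁻¹).toRingHom
  change IsCoprime (Subring.centerCongr (φ ^ i)⁻¹ (Subring.centerCongr (φ ^ i) z))
    (Subring.centerCongr (φ ^ i)⁻¹ _) at hc
  rw [← Subring.centerCongr_mul, inv_mul_cancel, Subring.centerCongr_one] at hc
  refine (hc.pow_left (m := t)).smul_eq_zero (GWA.ofCenter φ (z : R)) ?_ ?_
  · rw [map_pow]
    exact ht
  · have h1 := congrArg (GWA.x φ (z : R) ^ i • ·) h
    simp only [smul_zero] at h1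
    rw [← mul_smul, zTorsion.x_pow_mul_y_pow] at h1
    exact h1

end Torsion

namespace IsInducing

variable {N M : Type v} [AddCommGroup N] [Module (GWA (φ ^ (k + 1)) (z : R)) N]
    [AddCommGroup M] [Module (GWA φ (z : R)) M] {ι : N →+ M}

/-- The summands yⁱ ι(N) are torsion for pairwise coprime elements zᵢ, so their sum is direct, and
each yⁱ is injective on z-torsion. -/
theorem lift_injective (h : IsInducing (φ := φ) (z := z) (k := k) ι)
    (hcop : ∀ i, 1 ≤ i → i ≤ k → IsCoprime z (Subring.centerCongr (φ ^ i) z))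
    (hι : Function.Injective ι) (hmem : ∀ n, ι n ∈ zTorsion φ z M) :
    Function.Injective h.lift := by
  rw [injective_iff_map_eq_zero]
  intro f hf
  choose t ht using fun i => hmem (f i)
  -- One exponent that serves all components.
  set s := ∑ i, t i
  have hs (i : Fin (k + 1)) : GWA.C φ (z : R) (z : R) ^ s • ι (f i) = 0 :=
    zTorsion.pow_smul_of_le (ht i) (Finset.single_le_sum (fun _ _ => Nat.zero_le _)
      (Finset.mem_univ i))
  have hys (i : Fin (k + 1)) : GWA.ofCenter φ (z : R) (Subring.centerCongr (φ ^ (i : ℕ)) z ^ s) •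
      GWA.y φ (z : R) ^ (i : ℕ) • ι (f i) = 0 := by
    rw [← mul_smul, ← map_pow (Subring.centerCongr _), ← GWA.y_pow_mul_ofCenter, mul_smul, map_pow]
    exact (congrArg _ (hs i)).trans (smul_zero _)
  ext j
  apply hι
  refine Eq.trans ?_ (map_zero ι).symm
  refine eq_zero_of_y_pow_smul_eq_zero hcop (Nat.lt_succ_iff.mp j.2) (hmem _) ?_
  have hc : IsCoprime (Subring.centerCongr (φ ^ (j : ℕ)) z ^ s)
      (∏ i ∈ Finset.univ.erase j, Subring.centerCongr (φ ^ (i : ℕ)) z ^ s) :=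
    IsCoprime.prod_right fun i hi => Subring.pairwise_isCoprime_centerCongr_pow hcop s
      (Finset.ne_of_mem_erase hi).symm
  refine hc.smul_eq_zero (GWA.ofCenter φ (z : R)) (hys j) ?_
  -- Multiplying the relation by ∏_{i ≠ j} zᵢˢ kills every term but the j-th. That term is therefore
  -- annihilated both by this product and by zⱼˢ, which are coprime.
  have h1 := congrArg (GWA.ofCenter φ (z : R) (∏ i ∈ Finset.univ.erase j,
    Subring.centerCongr (φ ^ (i : ℕ)) z ^ s) • ·) ((h.lift_apply f).symm.trans hf)
  simp only [smul_zero, Finset.smul_sum] at h1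
  rwa [Finset.sum_eq_single j (fun i _ hij => ?_) (fun hj => absurd (Finset.mem_univ j) hj)] at h1
  obtain ⟨c, hc⟩ := Finset.dvd_prod_of_mem
    (fun i : Fin (k + 1) => Subring.centerCongr (φ ^ (i : ℕ)) z ^ s)
    (Finset.mem_erase.mpr ⟨hij, Finset.mem_univ i⟩)
  rw [hc, mul_comm, map_mul, mul_smul, hys, smul_zero]

/-- A partition of unity ∑ μᵢ ∏_{j ≠ i} zⱼᵗ = 1 splits m into pieces killed by zᵢᵗ, and each such
piece lies in yⁱ M^{z^∞}. -/
theorem lift_surjective (h : IsInducing (φ := φ) (z := z) (k := k) ι)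
    (hnil : IsNilpotent (Subring.centerCongr (φ ^ (k + 1)) z - z))
    (hcop : ∀ i, 1 ≤ i → i ≤ k → IsCoprime z (Subring.centerCongr (φ ^ i) z))
    (hM : ∀ m : M, ∃ n : ℕ, GWA.x φ (z : R) ^ n • m = 0)
    (hrange : ∀ m ∈ zTorsion φ z M, ∃ n, ι n = m) :
    Function.Surjective h.lift := by
  intro m
  obtain ⟨n, hn⟩ := hM m
  obtain ⟨t, ht⟩ := exists_prod_pow_smul_eq_zero hnil n
    (zTorsion.pow_smul_of_le hn (Nat.le_mul_of_pos_left n (Nat.succ_pos k)))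
  obtain ⟨μ, hμ⟩ := exists_sum_eq_one_iff_pairwise_coprime'.mpr
    (Subring.pairwise_isCoprime_centerCongr_pow hcop t)
  have hex (i : Fin (k + 1)) : ∃ n, GWA.y φ (z : R) ^ (i : ℕ) • ι n = GWA.ofCenter φ (z : R)
      (μ i * ∏ j ∈ {i}ᶜ, Subring.centerCongr (φ ^ (j : ℕ)) z ^ t) • m := by
    obtain ⟨w, hw, hwm⟩ := exists_y_pow_smul_eq (t := t) hcop (Nat.lt_succ_iff.mp i.2)
      (w := GWA.ofCenter φ (z : R)
        (μ i * ∏ j ∈ {i}ᶜ, Subring.centerCongr (φ ^ (j : ℕ)) z ^ t) • m) (by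
        rw [← mul_smul, ← map_mul, mul_left_comm,
          ← Finset.prod_singleton (fun j : Fin (k + 1) => Subring.centerCongr (φ ^ (j : ℕ)) z ^ t) i,
          Finset.prod_mul_prod_compl, Finset.prod_pow, Fin.prod_univ_eq_prod_range
            (fun j => Subring.centerCongr (φ ^ j) z), map_mul, mul_smul, map_pow]
        exact (congrArg _ ht).trans (smul_zero _))
    obtain ⟨n, rfl⟩ := hrange w hw
    exact ⟨n, hwm⟩
  choose g hg using hex
  refine ⟨∑ i, InducedModule.single φ z i (g i), ?_⟩
  rw [map_sum]
  simp only [lift_single, hg]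
  rw [← Finset.sum_smul, ← map_sum, hμ, map_one, one_smul]

/-- The corestriction to `M^{z^∞}`. -/
def toTorsion (ι : N →+ M) (hmem : ∀ n, ι n ∈ zTorsion φ z M) : N →+ zTorsion φ z M where
  toFun n := ⟨ι n, hmem n⟩
  map_zero' := Subtype.ext (map_zero ι)
  map_add' _ _ := Subtype.ext (map_add ι _ _)

/-- If ι identifies N with M^{z^∞} as a group, the compatibilities of `IsInducing` already determine
the action of the smaller algebra; only x, which involves Φ⁻¹, needs an argument. -/
theorem toTorsion_smul (h : IsInducing (φ := φ) (z := z) (k := k) ι)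
    (hl : 1 ≤ k + 1) (hnil : IsNilpotent (Subring.centerCongr (φ ^ (k + 1)) z - z))
    (hc : IsCoprime z (rescaling φ z (k + 1))) (hmem : ∀ n, ι n ∈ zTorsion φ z M)
    (hinj : Function.Injective ι) (hrange : ∀ m ∈ zTorsion φ z M, ∃ n, ι n = m)
    (a : GWA (φ ^ (k + 1)) (z : R)) (n : N) :
    toTorsion ι hmem (a • n) = zTorsion.action M hl hnil hc a (toTorsion ι hmem n) := by
  induction a using GWA.induction generalizing n with
  | hC r =>
    rw [zTorsion.action, GWA.lift_C]
    exact Subtype.ext (h.map_C r n)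
  | hy =>
    rw [zTorsion.action, GWA.lift_y]
    exact Subtype.ext (h.map_y n)
  | hadd a b ha hb =>
    rw [add_smul, map_add, map_add, ha, hb]
    rfl
  | hmul a b ha hb =>
    rw [mul_smul, map_mul, ha, hb]
    rfl
  | hx =>
    rw [zTorsion.action, GWA.lift_x]
    apply Subtype.ext
    change ι (GWA.x (φ ^ (k + 1)) (z : R) • n) = GWA.x φ (z : R) ^ (k + 1) •
      (zTorsion.rescale M hc (toTorsion ι hmem n) : M)
    obtain ⟨n', hn'⟩ := hrange _ (zTorsion.rescale M hc (toTorsion ι hmem n)).2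
    have h1 := congrArg Subtype.val (zTorsion.actC_rescale hc (toTorsion ι hmem n))
    rw [zTorsion.coe_actC, ← hn', ← h.map_C] at h1
    have h2 : GWA.C (φ ^ (k + 1)) (z : R) (rescaling φ z (k + 1) : R) • n' = n := hinj h1
    -- With n = Φ n', the left side is φ^(-(k+1))(Φ) · ι(x n'), and the right side is xᵏ · x ι(n') =
    -- xᵏyᵏ ι(x n'). The two coefficients agree because Φ = φ(z₀⋯z_{k-1}).
    rw [← hn', ← h2, ← mul_smul, GWA.x_mul_C, pow_succ (GWA.x φ (z : R)), mul_smul (GWA.C _ _ _),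
      mul_smul (_ ^ k), ← h.map_x, ← mul_smul (_ ^ k), zTorsion.x_pow_mul_y_pow, ← h.map_C]
    congr 3
    rw [RingAut.inv_pow_succ_apply, rescaling_succ]
    congr 1
    exact φ.symm_apply_apply _

end IsInducing

/-! ### The induced module lies in 𝒪, and its z-torsion is y⁰N. -/

namespace InducedModule

variable {N : Type v} [AddCommGroup N] [Module (GWA (φ ^ (k + 1)) (z : R)) N]

theorem single_mem_zTorsion {n : N} (hn : ∃ t : ℕ, GWA.C (φ ^ (k + 1)) (z : R) (z : R) ^ t • n = 0) :
    single φ z (k := k) 0 n ∈ zTorsion φ z (InducedModule φ z k N) := by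
  obtain ⟨t, ht⟩ := hn
  refine ⟨t, ?_⟩
  rw [← map_pow, C_smul_single, Fin.val_zero, pow_zero, inv_one, RingAut.one_apply, map_pow, ht,
    map_zero]

theorem exists_single_eq
    (hcop : ∀ i, 1 ≤ i → i ≤ k → IsCoprime z (Subring.centerCongr (φ ^ i) z))
    (hN : ∀ n : N, ∃ t : ℕ, GWA.C (φ ^ (k + 1)) (z : R) (z : R) ^ t • n = 0)
    {f : InducedModule φ z k N} (hf : f ∈ zTorsion φ z (InducedModule φ z k N)) :
    ∃ n : N, single φ z 0 n = f := by
  obtain ⟨t, ht⟩ := hf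
  refine ⟨f 0, ?_⟩
  ext i
  by_cases hi : i = 0
  · rw [hi, single_same]
  · rw [single_ne hi]
    obtain ⟨s, hs⟩ := hN (f i)
    -- The i-th coordinate is killed by a power of z, by local nilpotence on N, and by a power of
    -- φ⁻ⁱ(z), through which z acts on yⁱN.
    refine (IsCoprime.smul_eq_zero (GWA.ofCenter (φ ^ (k + 1)) (z : R))
      ((Subring.isCoprime_centerCongr_inv hcop (Nat.one_le_iff_ne_zero.mpr
        (Fin.val_ne_zero_iff.mpr hi)) (Nat.lt_succ_iff.mp i.2)).pow (m := s) (n := t)) ?_ ?_).symm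
    · rw [map_pow]
      exact hs
    · have h1 := congrArg (fun g : InducedModule φ z k N => g i) ht
      simp only [← map_pow, C_smul_apply] at h1
      rw [← map_pow (Subring.centerCongr _)]
      exact h1

theorem exists_x_pow_smul_eq_zero
    (hN : ∀ n : N, ∃ t : ℕ, GWA.x (φ ^ (k + 1)) (z : R) ^ t • n = 0) (f : InducedModule φ z k N) :
    ∃ t : ℕ, GWA.x φ (z : R) ^ t • f = 0 := by
  -- On y⁰N the operator x^(k+1) = xᵏ · x sends n to xᵏyᵏ(x n), an R-multiple of x n, and
  -- coefficients in R pass through powers of x.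
  have key (t : ℕ) (n : N) (hn : GWA.x (φ ^ (k + 1)) (z : R) ^ t • n = 0) :
      GWA.x φ (z : R) ^ ((k + 1) * t) • single φ z (k := k) 0 n = 0 := by
    induction t generalizing n with
    | zero =>
      rw [pow_zero, one_smul] at hn
      rw [hn, map_zero, smul_zero]
    | succ t ih =>
      rw [Nat.mul_succ, pow_add, mul_smul, pow_succ _ k, mul_smul _ _ (single _ _ _ _),
        x_smul_single_zero, ← y_pow_smul_single_zero, Fin.val_last, ← mul_smul (_ ^ k),
        zTorsion.x_pow_mul_y_pow, C_smul_single]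
      refine ih _ ?_
      rw [← mul_smul, GWA.x_pow_mul_C, mul_smul, ← mul_smul (_ ^ t), ← pow_succ, hn, smul_zero]
  rw [← sum_single f]
  refine Finset.sum_induction _ (fun g => ∃ t : ℕ, GWA.x φ (z : R) ^ t • g = 0) ?_
    ⟨0, smul_zero _⟩ fun i _ => ?_
  · rintro a b ⟨s, hs⟩ ⟨t, ht⟩
    refine ⟨s + t, ?_⟩
    rw [smul_add, zTorsion.pow_smul_of_le hs (Nat.le_add_right s t),
      zTorsion.pow_smul_of_le ht (Nat.le_add_left t s), add_zero]
  · obtain ⟨t, ht⟩ := hN (f i)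
    -- The extra i factors bring yⁱn back to degree 0, up to a coefficient in R.
    refine ⟨(k + 1) * t + i, ?_⟩
    rw [← y_pow_smul_single_zero, pow_add, mul_smul, ← mul_smul (_ ^ (i : ℕ)),
      zTorsion.x_pow_mul_y_pow, ← mul_smul, GWA.x_pow_mul_C, mul_smul, key t _ ht, smul_zero]

end InducedModule

end

/-! ### Extension of scalars and its universal property. -/

namespace ExtendScalars

variable {A B N P : Type*} [Ring A] [Ring B] (f : A →+* B) [AddCommGroup N] [Module A N]
  [AddCommGroup P] [Module B P]

/-- The map `N → B ⊗_A N`, `n ↦ 1 ⊗ n`. -/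
def unit (N : Type*) [AddCommGroup N] [Module A N] : N →+ ExtendScalars f N where
  toFun n := Submodule.Quotient.mk (1 ⊗ₜ n)
  map_zero' := by rw [TensorProduct.tmul_zero, Submodule.Quotient.mk_zero]
  map_add' _ _ := by rw [TensorProduct.tmul_add, Submodule.Quotient.mk_add]

theorem smul_unit (b : B) (n : N) :
    b • unit f N n = (Submodule.Quotient.mk (b ⊗ₜ n) : ExtendScalars f N) := by
  change b • Submodule.Quotient.mk _ = _
  rw [← Submodule.Quotient.mk_smul, TensorProduct.smul_tmul', smul_eq_mul, mul_one]

theorem unit_smul (a : A) (n : N) : unit f N (a • n) = f a • unit f N n := by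
  rw [smul_unit]
  symm
  refine (Submodule.Quotient.eq _).mpr (Submodule.subset_span ?_)
  exact ⟨1, a, n, by rw [one_mul]⟩

theorem induction {p : ExtendScalars f N → Prop} (hunit : ∀ (b : B) n, p (b • unit f N n))
    (hadd : ∀ s t, p s → p t → p (s + t)) (t : ExtendScalars f N) : p t := by
  obtain ⟨t, rfl⟩ := Submodule.Quotient.mk_surjective _ t
  induction t with
  | zero =>
    have := hunit 0 0
    rwa [zero_smul] at this
  | tmul b n => exact smul_unit f b n ▸ hunit b n
  | add s t hs ht => exact hadd _ _ hs ht

variable {f}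

/-- The universal property of `B ⊗_A N`. -/
def lift (ι : N →+ P) (hι : ∀ (a : A) n, ι (a • n) = f a • ι n) : ExtendScalars f N →ₗ[B] P :=
  Submodule.liftQ _ (TensorProduct.AlgebraTensorModule.lift
    (LinearMap.toSpanSingleton B (N →ₗ[ℤ] P) ι.toIntLinearMap)) (by
      rw [Submodule.span_le]
      rintro _ ⟨b, a, n, rfl⟩
      change _ = _
      rw [map_sub, TensorProduct.AlgebraTensorModule.lift_tmul,
        TensorProduct.AlgebraTensorModule.lift_tmul, sub_eq_zero]
      change (b * f a) • ι n = b • ι (a • n)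
      rw [hι, mul_smul])

theorem lift_unit (ι : N →+ P) (hι : ∀ (a : A) n, ι (a • n) = f a • ι n) (n : N) :
    lift ι hι (unit f N n) = ι n := by
  change (1 : B) • ι n = ι n
  rw [one_smul]

end ExtendScalars

/-! ### Extension of scalars along the Frobenius. -/

namespace TwistedPoly

variable {R : Type u} [Ring R]

theorem induction {φ : RingAut R} {p : TwistedPoly φ → Prop} (hC : ∀ r, p (C φ r)) (hy : p (y φ))
    (hadd : ∀ a b, p a → p b → p (a + b)) (hmul : ∀ a b, p a → p b → p (a * b))
    (a : TwistedPoly φ) : p a := by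
  have hpow (n : ℕ) : p (y φ ^ n) := by
    induction n with
    | zero =>
      rw [pow_zero, ← map_one (C φ)]
      exact hC 1
    | succ n ih =>
      rw [pow_succ]
      exact hmul _ _ ih hy
  induction a using SkewPolynomial.induction with
  | h0 =>
    rw [← map_zero (C φ)]
    exact hC 0
  | ha n r q _ _ hq =>
    refine hadd _ _ ?_ hq
    rw [← SkewPolynomial.C_mul_X_pow_eq_monomial]
    exact hmul _ _ (hC r) (hpow n)

theorem frobenius_C (φ : RingAut R) (l : ℕ) (r : R) : frobenius φ l (C (φ ^ l) r) = C φ r :=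
  lift_C ..

theorem frobenius_y (φ : RingAut R) (l : ℕ) : frobenius φ l (y (φ ^ l)) = y φ ^ l :=
  lift_y ..

theorem toGWA_C (φ : RingAut R) (z r : R) : toGWA φ z (C φ r) = GWA.C φ z r :=
  lift_C ..

theorem toGWA_y (φ : RingAut R) (z : R) : toGWA φ z (y φ) = GWA.y φ z :=
  lift_y ..

variable {φ : RingAut R} {k : ℕ} {N P : Type*} [AddCommGroup N]
  [Module (TwistedPoly (φ ^ (k + 1))) N] [AddCommGroup P] [Module (TwistedPoly φ) P]

/-- The sums ∑ yⁱ ⊗ nᵢ with i ≤ k contain all 1 ⊗ n and form a submodule: r yⁱ = yⁱ φ⁻ⁱ(r) gives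
stability under R, and y^(k+1) ⊗ n = 1 ⊗ y n stability under y. -/
theorem exists_sum_y_pow_smul_unit (t : ExtendScalars (frobenius φ (k + 1)) N) :
    ∃ g : Fin (k + 1) → N, ∑ i : Fin (k + 1), y φ ^ (i : ℕ) •
      ExtendScalars.unit (frobenius φ (k + 1)) N (g i) = t := by
  let u := ExtendScalars.unit (frobenius φ (k + 1)) N
  let T : AddSubgroup (ExtendScalars (frobenius φ (k + 1)) N) :=
    { carrier := {t | ∃ g : Fin (k + 1) → N, ∑ i : Fin (k + 1), y φ ^ (i : ℕ) • u (g i) = t}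
      zero_mem' := ⟨0, Finset.sum_eq_zero fun i _ => by
        rw [Pi.zero_apply, map_zero, smul_zero]⟩
      add_mem' := by
        rintro _ _ ⟨g, rfl⟩ ⟨h, rfl⟩
        refine ⟨g + h, ?_⟩
        simp only [Pi.add_apply, map_add, smul_add, Finset.sum_add_distrib]
      neg_mem' := by
        rintro _ ⟨g, rfl⟩
        refine ⟨-g, ?_⟩
        simp only [Pi.neg_apply, map_neg, smul_neg, Finset.sum_neg_distrib] }
  have hT (i : Fin (k + 1)) (n : N) : y φ ^ (i : ℕ) • u n ∈ T := by
    refine ⟨Pi.single i n, ?_⟩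
    rw [Finset.sum_eq_single i (fun j _ h => ?_) (fun h => absurd (Finset.mem_univ i) h),
      Pi.single_eq_same]
    rw [Pi.single_eq_of_ne h, map_zero, smul_zero]
  have hsmul (b : TwistedPoly φ) : ∀ t ∈ T, b • t ∈ T := by
    induction b using induction with
    | hC r =>
      rintro _ ⟨g, rfl⟩
      rw [Finset.smul_sum]
      refine sum_mem fun i _ => ?_
      have h1 := y_pow_mul_C φ i ((φ ^ (i : ℕ))⁻¹ r)
      rw [← RingAut.mul_apply, mul_inv_cancel, RingAut.one_apply] at h1
      have h2 := ExtendScalars.unit_smul (frobenius φ (k + 1)) (C (φ ^ (k + 1))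
        ((φ ^ (i : ℕ))⁻¹ r)) (g i)
      rw [frobenius_C] at h2
      rw [← mul_smul, ← h1, mul_smul]
      exact h2 ▸ hT i _
    | hy =>
      rintro _ ⟨g, rfl⟩
      rw [Finset.smul_sum]
      refine sum_mem fun i _ => ?_
      rw [← mul_smul, ← pow_succ']
      cases i using Fin.lastCases with
      | cast i => exact hT i.succ _
      | last =>
        have h2 := ExtendScalars.unit_smul (frobenius φ (k + 1)) (y (φ ^ (k + 1))) (g (Fin.last k))
        rw [frobenius_y] at h2
        have h3 := hT 0 (y (φ ^ (k + 1)) • g (Fin.last k))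
        rw [Fin.val_zero, pow_zero, one_smul] at h3
        exact h2 ▸ h3
    | hadd a b ha hb =>
      intro t ht
      rw [add_smul]
      exact add_mem (ha t ht) (hb t ht)
    | hmul a b ha hb =>
      intro t ht
      rw [mul_smul]
      exact ha _ (hb t ht)
  change t ∈ T
  induction t using ExtendScalars.induction with
  | hunit b n =>
    refine hsmul b _ ?_
    have := hT 0 n
    rwa [Fin.val_zero, pow_zero, one_smul] at this
  | hadd s t hs ht => exact add_mem hs ht

/-- Uniqueness of the expression ∑ yⁱ ⊗ nᵢ need not be known beforehand: two such sums with the same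
image have the same coefficients because the map to P is injective on coefficient families. -/
theorem bijective_lift_of_bijective (ι : N →+ P)
    (hι : ∀ (a : TwistedPoly (φ ^ (k + 1))) n, ι (a • n) = frobenius φ (k + 1) a • ι n)
    (hbij : Function.Bijective fun g : Fin (k + 1) → N => ∑ i : Fin (k + 1), y φ ^ (i : ℕ) • ι (g i)) :
    Function.Bijective (ExtendScalars.lift ι hι) := by
  have h (g : Fin (k + 1) → N) : ExtendScalars.lift ι hι (∑ i : Fin (k + 1), y φ ^ (i : ℕ) •
      ExtendScalars.unit (frobenius φ (k + 1)) N (g i)) = ∑ i : Fin (k + 1), y φ ^ (i : ℕ) • ι (g i) := by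
    rw [map_sum]
    refine Finset.sum_congr rfl fun i _ => ?_
    rw [map_smul, ExtendScalars.lift_unit]
  constructor
  · intro s t hst
    obtain ⟨g, rfl⟩ := exists_sum_y_pow_smul_unit s
    obtain ⟨g', rfl⟩ := exists_sum_y_pow_smul_unit t
    rw [h, h] at hst
    rw [hbij.1 hst]
  · intro m
    obtain ⟨g, hg⟩ := hbij.2 m
    exact ⟨_, (h g).trans hg⟩

end TwistedPoly

/-! ### The equivalence of categories. -/

section Equivalence

variable {R : Type u} [Ring R] {φ : RingAut R} {z : Subring.center R} {k : ℕ}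

namespace IsInducing

theorem comp {N N' M : Type v} [AddCommGroup N] [Module (GWA (φ ^ (k + 1)) (z : R)) N]
    [AddCommGroup N'] [Module (GWA (φ ^ (k + 1)) (z : R)) N'] [AddCommGroup M]
    [Module (GWA φ (z : R)) M] {ι : N →+ M} (h : IsInducing (φ := φ) (z := z) (k := k) ι)
    (g : N' →ₗ[GWA (φ ^ (k + 1)) (z : R)] N) :
    IsInducing (φ := φ) (z := z) (k := k) (ι.comp g.toAddMonoidHom) where
  map_C r _ := (congrArg ι (map_smul g _ _)).trans (h.map_C r _)
  map_y _ := (congrArg ι (map_smul g _ _)).trans (h.map_y _)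
  map_x _ := (congrArg (fun t => _ • ι t) (map_smul g _ _)).trans (h.map_x _)

/-- The relation for x is yᵏ x^(k+1) Φ⁻¹ = (z₀⋯z_{k-1}) x Φ⁻¹ = x φ(z₀⋯z_{k-1}) Φ⁻¹ = x. -/
theorem subtype {M : Type v} [AddCommGroup M] [Module (GWA φ (z : R)) M] (hl : 1 ≤ k + 1)
    (hnil : IsNilpotent (Subring.centerCongr (φ ^ (k + 1)) z - z))
    (hc : IsCoprime z (rescaling φ z (k + 1))) :
    letI := zTorsion.module M hl hnil hc
    IsInducing (φ := φ) (z := z) (k := k) (zTorsion φ z M).subtype :=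
  letI := zTorsion.module M hl hnil hc
  { map_C := fun r n => by
      change ((zTorsion.action M hl hnil hc (GWA.C _ _ r) n : zTorsion φ z M) : M) = _
      rw [zTorsion.action, GWA.lift_C]
      rfl
    map_y := fun n => by
      change ((zTorsion.action M hl hnil hc (GWA.y _ _) n : zTorsion φ z M) : M) = _
      rw [zTorsion.action, GWA.lift_y]
      rfl
    map_x := fun n => by
      change _ • ((zTorsion.action M hl hnil hc (GWA.x _ _) n : zTorsion φ z M) : M) = _
      rw [zTorsion.action, GWA.lift_x]
      change GWA.y φ (z : R) ^ k • GWA.x φ (z : R) ^ (k + 1) • (zTorsion.rescale M hc n : M) =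
        GWA.x φ (z : R) • (n : M)
      have h1 := congrArg Subtype.val (zTorsion.actC_rescale hc n)
      rw [zTorsion.coe_actC] at h1
      rw [← h1, pow_succ, mul_smul, ← mul_smul, zTorsion.y_pow_mul_x_pow, rescaling_succ,
        ← mul_smul (GWA.x φ (z : R)), GWA.x_mul_C, mul_smul]
      congr 2
      exact (φ.symm_apply_apply _).symm }

theorem map_toGWA_smul {N M : Type v} [AddCommGroup N] [Module (GWA (φ ^ (k + 1)) (z : R)) N]
    [AddCommGroup M] [Module (GWA φ (z : R)) M] {ι : N →+ M}
    (h : IsInducing (φ := φ) (z := z) (k := k) ι) (a : TwistedPoly (φ ^ (k + 1))) (n : N) :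
    ι (TwistedPoly.toGWA (φ ^ (k + 1)) (z : R) a • n) =
      TwistedPoly.toGWA φ (z : R) (TwistedPoly.frobenius φ (k + 1) a) • ι n := by
  induction a using TwistedPoly.induction generalizing n with
  | hC r => rw [TwistedPoly.frobenius_C, TwistedPoly.toGWA_C, TwistedPoly.toGWA_C, h.map_C]
  | hy =>
    rw [TwistedPoly.frobenius_y, TwistedPoly.toGWA_y, map_pow, TwistedPoly.toGWA_y, h.map_y]
  | hadd a b ha hb => simp only [map_add, add_smul, ha, hb]
  | hmul a b ha hb => simp only [map_mul, mul_smul, ha, hb]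

end IsInducing

theorem isCoprime_of_span_pair_eq_top {S : Type*} [CommRing S] {s t : S}
    (h : Ideal.span {s, t} = ⊤) : IsCoprime s t := by
  rwa [Ideal.eq_top_iff_one, Ideal.mem_span_pair] at h

theorem isCoprime_centerCongr_of_span
    (hcop : ∀ i, 1 ≤ i → i ≤ k + 1 - 1 → Ideal.span {z, Subring.centerCongr (φ ^ i) z} = ⊤)
    (i : ℕ) (h1 : 1 ≤ i) (hi : i ≤ k) : IsCoprime z (Subring.centerCongr (φ ^ i) z) :=
  isCoprime_of_span_pair_eq_top (hcop i h1 hi)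

variable (hl : 1 ≤ k + 1) (hnil : IsNilpotent (Subring.centerCongr (φ ^ (k + 1)) z - z))
  (hcop : ∀ i, 1 ≤ i → i ≤ k + 1 - 1 → Ideal.span {z, Subring.centerCongr (φ ^ i) z} = ⊤)

/-- The inclusion of `M^{z^∞}` in `M` as a map of the underlying groups. -/
def torsionInclusion (M : CategoryO.{u, v} φ (z : R)) :
    ((torsionFunctor.{u, v} φ z (k + 1) hl hnil hcop).obj M).obj →+ M.obj :=
  (zTorsion φ z M.obj).subtype

theorem isInducing_torsionInclusion (M : CategoryO.{u, v} φ (z : R)) :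
    IsInducing (φ := φ) (z := z) (k := k) (torsionInclusion hl hnil hcop M) :=
  IsInducing.subtype hl hnil _

theorem bijective_lift_torsionInclusion (M : CategoryO.{u, v} φ (z : R)) :
    Function.Bijective (isInducing_torsionInclusion hl hnil hcop M).lift :=
  ⟨IsInducing.lift_injective _ (isCoprime_centerCongr_of_span hcop) Subtype.val_injective
      fun n => n.2,
    IsInducing.lift_surjective _ hnil (isCoprime_centerCongr_of_span hcop) M.property
      fun m hm => ⟨⟨m, hm⟩, rfl⟩⟩

/-- M is generated by M^{z^∞}, so a homomorphism is determined by its restriction. -/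
theorem torsionFunctor_faithful :
    (torsionFunctor.{u, v} φ z (k + 1) hl hnil hcop).Faithful where
  map_injective {M M'} f g hfg := by
    have h (n : zTorsion φ z M.obj) : f.hom.hom (n : M.obj) = g.hom.hom (n : M.obj) :=
      congrArg Subtype.val (congrArg (fun t => t.hom.hom n) hfg)
    apply ObjectProperty.hom_ext
    apply ModuleCat.hom_ext
    ext m
    obtain ⟨t, rfl⟩ := (bijective_lift_torsionInclusion hl hnil hcop M).2 m
    rw [IsInducing.lift_apply, map_sum, map_sum]
    refine Finset.sum_congr rfl fun i _ => ?_
    rw [map_smul, map_smul]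
    exact congrArg _ (h _)

/-- A homomorphism g between torsion parts, followed by the inclusion in M', is again inducing. It
extends to the induced module, which is identified with M by `e`. -/
theorem torsionFunctor_full :
    (torsionFunctor.{u, v} φ z (k + 1) hl hnil hcop).Full where
  map_surjective {M M'} g := by
    let e := LinearEquiv.ofBijective _ (bijective_lift_torsionInclusion hl hnil hcop M)
    have hg := (isInducing_torsionInclusion hl hnil hcop M').comp g.hom.hom
    refine ⟨ObjectProperty.homMk (ModuleCat.ofHom (hg.lift ∘ₗ e.symm.toLinearMap)), ?_⟩
    apply ObjectProperty.hom_ext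
    apply ModuleCat.hom_ext
    ext n
    apply Subtype.ext
    change hg.lift (e.symm (torsionInclusion hl hnil hcop M n)) =
      torsionInclusion hl hnil hcop M' (g.hom.hom n)
    have h1 : e (InducedModule.single φ z 0 n) = torsionInclusion hl hnil hcop M n := by
      refine ((isInducing_torsionInclusion hl hnil hcop M).lift_single 0 n).trans ?_
      rw [Fin.val_zero, pow_zero, one_smul]
    rw [← h1, LinearEquiv.symm_apply_apply, IsInducing.lift_single, Fin.val_zero, pow_zero,
      one_smul]
    rfl

theorem torsionFunctor_essSurj :
    (torsionFunctor.{u, v} φ z (k + 1) hl hnil hcop).EssSurj where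
  mem_essImage N := by
    -- The preimage of N is the induced module; n ↦ y⁰n identifies N with its z-torsion.
    let M : CategoryO.{u, v} φ (z : R) :=
      { obj := ModuleCat.of (GWA φ (z : R)) (InducedModule φ z k N.obj)
        property := InducedModule.exists_x_pow_smul_eq_zero N.property }
    have htors (n : N.obj) := exists_pow_smul_eq_zero (φ := φ ^ (k + 1)) hnil (N.property n)
    have hmem (n : N.obj) := InducedModule.single_mem_zTorsion (k := k) (htors n)
    have hinj : Function.Injective (InducedModule.single φ z (k := k) (N := N.obj) 0) :=
      Function.LeftInverse.injective (g := fun f => f 0) fun n => InducedModule.single_same 0 n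
    have hrange (m : InducedModule φ z k N.obj)
        (hm : m ∈ zTorsion φ z (InducedModule φ z k N.obj)) :=
      InducedModule.exists_single_eq (isCoprime_centerCongr_of_span hcop) htors hm
    let g : N.obj →ₗ[GWA (φ ^ (k + 1)) (z : R)]
        ((torsionFunctor.{u, v} φ z (k + 1) hl hnil hcop).obj M).obj :=
      { toFun := IsInducing.toTorsion (InducedModule.single φ z 0) hmem
        map_add' := map_add _
        map_smul' := IsInducing.single.toTorsion_smul hl hnil _ hmem hinj hrange }
    have hg : Function.Bijective g :=
      ⟨fun a b hab => hinj (congrArg Subtype.val hab), fun m => by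
        obtain ⟨n, hn⟩ := hrange _ m.2
        exact ⟨n, Subtype.ext hn⟩⟩
    exact ⟨M, ⟨ObjectProperty.isoMk _
      (LinearEquiv.toModuleIso (LinearEquiv.ofBijective g hg)).symm⟩⟩

end Equivalence

end

theorem mainTheorem1 {R : Type u} [Ring R] (φ : RingAut R) (z b : Subring.center R) (l : ℕ)
    (hl : 1 ≤ l) (hb : IsNilpotent b) (hz : (b : R) ∣ (φ ^ l) (z : R) - z)
    (hcop : ∀ i, 1 ≤ i → i ≤ l - 1 → Ideal.span {z, Subring.centerCongr (φ ^ i) z} = ⊤) :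
    (torsionFunctor.{u, v} φ z l hl (isNilpotent_of_dvd φ z l hb hz) hcop).IsEquivalence ∧
    ∀ M : CategoryO.{u, v} φ (z : R), ∃ N : CategoryO.{u, v} (φ ^ l) (z : R),
      Nonempty ((ModuleCat.restrictScalars (TwistedPoly.toGWA φ (z : R))).obj M.obj
        ≃ₗ[TwistedPoly φ]
        ExtendScalars (TwistedPoly.frobenius φ l)
          ((ModuleCat.restrictScalars (TwistedPoly.toGWA (φ ^ l) (z : R))).obj N.obj)) := by
  -- The index k is the top exponent in ⨁ yⁱN.
  obtain ⟨k, rfl⟩ : ∃ k, l = k + 1 := ⟨l - 1, by omega⟩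
  have hnil := isNilpotent_of_dvd φ z (k + 1) hb hz
  constructor
  · have := torsionFunctor_faithful.{u, v} hl hnil hcop
    have := torsionFunctor_full.{u, v} hl hnil hcop
    have := torsionFunctor_essSurj.{u, v} hl hnil hcop
    exact { }
  · intro M
    refine ⟨(torsionFunctor.{u, v} φ z (k + 1) hl hnil hcop).obj M, ⟨LinearEquiv.symm ?_⟩⟩
    have hι := isInducing_torsionInclusion hl hnil hcop M
    let N' := (ModuleCat.restrictScalars (TwistedPoly.toGWA (φ ^ (k + 1)) (z : R))).obj
      ((torsionFunctor.{u, v} φ z (k + 1) hl hnil hcop).obj M).obj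
    let M' := (ModuleCat.restrictScalars (TwistedPoly.toGWA φ (z : R))).obj M.obj
    let ι : N' →+ M' := torsionInclusion hl hnil hcop M
    refine LinearEquiv.ofBijective _
      (TwistedPoly.bijective_lift_of_bijective (N := N') (P := M') ι hι.map_toGWA_smul ?_)
    have hbij := bijective_lift_torsionInclusion hl hnil hcop M
    -- The required bijection is the isomorphism ⨁ yⁱ M^{z^∞} ≅ M already obtained, with y now
    -- acting through `TwistedPoly.toGWA`.
    refine (congrArg Function.Bijective (funext fun f => ?_ : (fun g : Fin (k + 1) → N' =>
      ∑ i : Fin (k + 1), TwistedPoly.y φ ^ (i : ℕ) • ι (g i)) = fun g => hι.lift g)).mpr hbij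
    refine Finset.sum_congr rfl fun i _ => ?_
    change TwistedPoly.toGWA φ (z : R) (TwistedPoly.y φ ^ (i : ℕ)) •
      torsionInclusion hl hnil hcop M (f i) = _
    rw [map_pow, TwistedPoly.toGWA_y]
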